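/- Let $q$ be a complex number with $0<|q|<1$. Write $(a;q)_n=\prod_{i=0}^{n-1}(1-aq^i)$, $(a;q)_\infty=\prod_{i\ge 0}(1-aq^i)$, $(a)_n=(a;q)_n$, $(q)_\infty=(q;q)_\infty$, and $(a,b,c;q)_\infty=(a;q)_\infty(b;q)_\infty(c;q)_\infty$. For integers $n,k$ let ${n \brack k}_q=(q^{n-k+1};q)_k/(q;q)_k$ if $k\ge 0$ and ${n\brack k}_q=0$ if $k<0$ (so for $0\le k\le n$ it equals $(q;q)_n/((q;q)_k(q;q)_{n-k})$, and it vanishes for $k>n\ge 0$); write ${n\brack k}={n\brack k}_q$, and $\binom{s}{2}=s(s-1)/2$ for every integer $s$. (1) For every integer $\ell\ge 0$, $$\sum_{n=0}^{\infty} \frac{q^{n(n+2)} (-q; q^2)_{n}}{(q^2; q^2)_{2n}} \sum_{m=-\infty}^{\infty} \sum_{k=0}^{\ell} (-1)^m q^{2\binom{2m+2k-\ell}{2}+ \binom{m+1}{2}} {\ell \brack k}\, F_n(2m+2k-\ell)$$ $$=\frac{2(q^2; q^2)_\infty}{(q)_\infty (q^4; q^4)_\infty} \sum_{j=0}^{\infty}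 (-1)^j q^{\binom{j+1}{2} + (2j+\ell)(4j+2\ell+1)} \big( 1 -q^{2(2j+\ell)+1} +q^{4(2j+\ell)+3} -q^{6(2j+\ell)+6} \big) (q^{j+1})_{\ell},$$ where $$F_n(s)={2n-1 \brack n-s}_{q^2} +q^{2s} {2n-1 \brack n-s-1}_{q^2} -q^{4s+2}{2n-1 \brack n-s-2}_{q^2} -q^{6(s+1)} {2n-1 \brack n-s-3}_{q^2}.$$ Here, for each $n$, the sum over $k$ is nonzero for only finitely many $m$, and the sums over $n$ and $j$ converge absolutely. (2) Moreover (the case $\ell=0$), $$1 +\sum_{n=1}^{\infty} \sum_{m=-\lfloor \frac{n-1}{2} \rfloor}^{\lfloor \frac{n}{2} \rfloor} \frac{(-1)^m q^{n(n+2)+m(9m-5)/2} (1+q^m)} {(q; q^2)_{n} (q^4; q^4)_{n}} {2n-1 \brack n-2m}_{q^2} =\frac{(q^2; q^4)_\infty}{(q)_\infty} \big( (q^6, q^{11}, q^{17}; q^{17})_\infty- q(q^2, q^{15}, q^{17}; q^{17})_\infty \big),$$ the sum over $n$ converging absolutely. -/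

import Mathlib

/-- The finite `q`-shifted factorial `(a; q)_n = ∏_{i=0}^{n-1} (1 - a q^i)`. -/
noncomputable def qPoch (a q : ℂ) (n : ℕ) : ℂ :=
  ∏ i ∈ Finset.range n, (1 - a * q ^ i)

/-- The infinite `q`-shifted factorial `(a; q)_∞ = ∏_{i ≥ 0} (1 - a q^i)`. -/
noncomputable def qPochInf (a q : ℂ) : ℂ :=
  ∏' i : ℕ, (1 - a * q ^ i)

/-- The product defining `(a; q)_∞` converges for `|q| < 1`. -/
theorem multipliable_qPochInf (a q : ℂ) (hq : ‖q‖ < 1) :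
    Multipliable fun i : ℕ => 1 - a * q ^ i := by
  have h : Summable fun i : ℕ => -(a * q ^ i) :=
    ((summable_geometric_of_norm_lt_one hq).mul_left a).neg
  simpa [sub_eq_add_neg] using Complex.multipliable_one_add_of_summable h

/-- The Gaussian binomial coefficient `[n, k]_q` for integers `n` and `k`, with the usual
convention that it is `(q^{n-k+1}; q)_k / (q; q)_k` for `k ≥ 0` and `0` for `k < 0`.
(For `n ≥ 0` this is `(q; q)_n / ((q; q)_k (q; q)_{n-k})` if `0 ≤ k ≤ n` and `0` otherwise;
see `qBinom_eq` and `qBinom_eq_zero`.  The only negative value of `n` used is `-1`.) -/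
noncomputable def qBinom (q : ℂ) (n k : ℤ) : ℂ :=
  if 0 ≤ k then qPoch (q ^ (n - k + 1)) q k.toNat / qPoch q q k.toNat else 0

theorem one_sub_pow_ne_zero {q : ℂ} (hq : ‖q‖ < 1) {n : ℕ} (hn : n ≠ 0) : 1 - q ^ n ≠ 0 := by
  intro h
  have h1 : ‖q ^ n‖ = 1 := by rw [← sub_eq_zero.mp h]; simp
  rw [norm_pow] at h1
  exact absurd h1 (pow_lt_one₀ (norm_nonneg q) hq hn).ne

theorem qPoch_self_ne_zero {q : ℂ} (hq : ‖q‖ < 1) (n : ℕ) : qPoch q q n ≠ 0 := by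
  refine Finset.prod_ne_zero_iff.mpr fun i _ => ?_
  rw [← pow_succ']
  exact one_sub_pow_ne_zero hq (Nat.succ_ne_zero i)

/-- Agreement with the quotient of `q`-factorials. -/
theorem qBinom_eq {q : ℂ} (hq : ‖q‖ < 1) {n k : ℕ} (hk : k ≤ n) :
    qBinom q n k = qPoch q q n / (qPoch q q k * qPoch q q (n - k)) := by
  obtain ⟨d, rfl⟩ := Nat.exists_eq_add_of_le hk
  have hz : q ^ (((k + d : ℕ) : ℤ) - k + 1) = q ^ (d + 1) := by
    rw [← zpow_natCast]; congr 1; push_cast; ring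
  have hsplit : qPoch q q (k + d) = qPoch q q d * qPoch (q ^ (d + 1)) q k := by
    unfold qPoch
    rw [add_comm k d, Finset.prod_range_add]
    congr 1
    refine Finset.prod_congr rfl fun i _ => ?_
    ring
  have h1 := qPoch_self_ne_zero hq k
  have h2 := qPoch_self_ne_zero hq d
  simp only [qBinom, Int.natCast_nonneg, if_true, Int.toNat_natCast, hz, hsplit,
    Nat.add_sub_cancel_left]
  field_simp

/-- Vanishing above the diagonal. -/
theorem qBinom_eq_zero {q : ℂ} (hq0 : q ≠ 0) {n k : ℕ} (hk : n < k) : qBinom q n k = 0 := by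
  have h : qPoch (q ^ ((n : ℤ) - k + 1)) q k = 0 := by
    refine Finset.prod_eq_zero (i := k - n - 1) (Finset.mem_range.mpr (by omega)) ?_
    rw [← zpow_natCast, ← zpow_add₀ hq0]
    have : (n : ℤ) - k + 1 + ((k - n - 1 : ℕ) : ℤ) = 0 := by omega
    rw [this]; simp
  simp [qBinom, h]

/-- The binomial coefficient `binom(s, 2) = s (s - 1) / 2` for an integer `s`. -/
def choose2 (s : ℤ) : ℤ := s * (s - 1) / 2

/-- The four-term combination of base-`q²` Gaussian binomials, with `s = 2m + 2k - ℓ`: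
`[2n-1, n-s] + q^{2s} [2n-1, n-s-1] - q^{4s+2} [2n-1, n-s-2] - q^{6(s+1)} [2n-1, n-s-3]`. -/
noncomputable def fourTerm (q : ℂ) (n : ℕ) (s : ℤ) : ℂ :=
  qBinom (q ^ 2) (2 * (n : ℤ) - 1) (n - s)
    + q ^ (2 * s) * qBinom (q ^ 2) (2 * (n : ℤ) - 1) (n - s - 1)
    - q ^ (4 * s + 2) * qBinom (q ^ 2) (2 * (n : ℤ) - 1) (n - s - 2)
    - q ^ (6 * (s + 1)) * qBinom (q ^ 2) (2 * (n : ℤ) - 1) (n - s - 3)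

/-- The sum over `0 ≤ k ≤ ℓ`, for fixed `n` and `m`. -/
noncomputable def innerTerm (q : ℂ) (l n : ℕ) (m : ℤ) : ℂ :=
  ∑ k ∈ Finset.range (l + 1),
    (-1) ^ m * q ^ (2 * choose2 (2 * m + 2 * (k : ℤ) - (l : ℤ)) + choose2 (m + 1))
      * qBinom q l k * fourTerm q n (2 * m + 2 * (k : ℤ) - (l : ℤ))

/-- The `n`-th term of the left side of the triple-sum identity. -/
noncomputable def lhsTerm (q : ℂ) (l n : ℕ) : ℂ :=
  q ^ (n * (n + 2)) * qPoch (-q) (q ^ 2) n / qPoch (q ^ 2) (q ^ 2) (2 * n)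
    * ∑' m : ℤ, innerTerm q l n m

/-- The `j`-th term of the right side of the triple-sum identity. -/
noncomputable def rhsTerm (q : ℂ) (l j : ℕ) : ℂ :=
  (-1) ^ j * q ^ ((j + 1).choose 2 + (2 * j + l) * (4 * j + 2 * l + 1))
    * (1 - q ^ (2 * (2 * j + l) + 1) + q ^ (4 * (2 * j + l) + 3) - q ^ (6 * (2 * j + l) + 6))
    * qPoch (q ^ (j + 1)) q l

/-- The `n`-th term (`n ≥ 1`) of the double sum, the inner sum running over
`-⌊(n-1)/2⌋ ≤ m ≤ ⌊n/2⌋`. -/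
noncomputable def doubleTerm (q : ℂ) (n : ℕ) : ℂ :=
  ∑ m ∈ Finset.Icc (-(((n : ℤ) - 1) / 2)) ((n : ℤ) / 2),
    (-1) ^ m * q ^ ((n : ℤ) * (n + 2) + m * (9 * m - 5) / 2) * (1 + q ^ m)
      / (qPoch q (q ^ 2) n * qPoch (q ^ 4) (q ^ 4) n)
      * qBinom (q ^ 2) (2 * (n : ℤ) - 1) (n - 2 * m)

/-! Write B_n(s) for `baileyTerm`. Up to the weight in n, the four-term combination is B_n(s) -
B_n(s+2) (`weight_mul_fourTerm`). A difference B_n(s) - B_n(s+1) loses the factor 1/(1+q^(2n)) and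
becomes a multiple of a conjugate Bailey pair relative to q² (`baileyTerm_sub_succ`). That pair is
summed over n by a limiting q-Gauss sum, so Σ_n (B_n(s) - B_n(s+2)) is `baileyConst` times the
four-term polynomial `quarticTerm` (`hasSum_baileyTerm_sub`).

Absolute convergence in (n, m) allows n to be summed before m. After m → m - k the quartic factor no
longer depends on k, and the finite q-binomial theorem collapses the k-sum into (q^(-N);q)_ℓ. The
resulting series over N ∈ ℤ vanishes for 0 ≤ N < ℓ, and its two remaining halves, N ≥ ℓ and N < 0,
both equal the right-hand series; hence the factor 2 (`tsum_bilateralTerm`).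

For ℓ = 0, summation by parts in m and the symmetry of the Gaussian binomials make each term with n
≥ 1 twice a term of the double sum. On the other side, the four monomials of `quarticTerm` fold into
two theta series of base q^17, evaluated by the Jacobi triple product. -/

section

open Filter Topology Finset

/-! ### Shifted factorials and reciprocal q-factorials -/

@[simp] theorem qPoch_zero (a q : ℂ) : qPoch a q 0 = 1 := by simp [qPoch]

theorem qPoch_succ (a q : ℂ) (n : ℕ) : qPoch a q (n + 1) = qPoch a q n * (1 - a * q ^ n) := by
  simp [qPoch, prod_range_succ]

theorem qPoch_succ' (a q : ℂ) (n : ℕ) : qPoch a q (n + 1) = (1 - a) * qPoch (a * q) q n := by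
  simp only [qPoch, prod_range_succ', pow_zero, mul_one]
  rw [mul_comm]
  congr 1
  exact prod_congr rfl fun i _ => by ring

theorem qPoch_add (a q : ℂ) (m n : ℕ) :
    qPoch a q (m + n) = qPoch a q m * qPoch (a * q ^ m) q n := by
  simp only [qPoch, prod_range_add]
  congr 1
  exact prod_congr rfl fun i _ => by ring

theorem tendsto_qPoch (a : ℂ) {q : ℂ} (hq : ‖q‖ < 1) :
    Tendsto (qPoch a q) atTop (𝓝 (qPochInf a q)) :=
  (multipliable_qPochInf a q hq).tendsto_prod_tprod_nat

theorem qPochInf_eq_mul (a : ℂ) {q : ℂ} (hq : ‖q‖ < 1) (n : ℕ) :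
    qPochInf a q = qPoch a q n * qPochInf (a * q ^ n) q := by
  refine tendsto_nhds_unique ((tendsto_qPoch a hq).comp (tendsto_add_atTop_nat n)) ?_
  have := (tendsto_qPoch (a * q ^ n) hq).const_mul (qPoch a q n)
  refine this.congr fun k => ?_
  rw [Function.comp_apply, add_comm k n, qPoch_add]

theorem qPochInf_self_ne_zero {q : ℂ} (hq : ‖q‖ < 1) : qPochInf q q ≠ 0 := by
  have h : Summable fun i : ℕ => ‖-(q * q ^ i)‖ :=
    (((summable_geometric_of_norm_lt_one hq).mul_left q).neg).norm
  have := tprod_one_add_ne_zero_of_summable (f := fun i : ℕ => -(q * q ^ i)) (fun i => ?_) h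
  · simpa [qPochInf, sub_eq_add_neg] using this
  · have := one_sub_pow_ne_zero hq (Nat.succ_ne_zero i)
    rwa [pow_succ', sub_eq_add_neg] at this

theorem exists_norm_qPoch_le (a : ℂ) {q : ℂ} (hq : ‖q‖ < 1) :
    ∃ K : ℝ, 0 < K ∧ ∀ n, ‖qPoch a q n‖ ≤ K := by
  obtain ⟨K, hK, h⟩ := (Metric.isBounded_range_of_tendsto _ (tendsto_qPoch a hq)).exists_pos_norm_le
  exact ⟨K, hK, fun n => h _ ⟨n, rfl⟩⟩

/-- The reciprocal `1 / (q; q)_k`, extended by zero to negative `k`. -/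
noncomputable def recipQFact (q : ℂ) (k : ℤ) : ℂ :=
  if 0 ≤ k then (qPoch q q k.toNat)⁻¹ else 0

theorem recipQFact_natCast (q : ℂ) (n : ℕ) : recipQFact q n = (qPoch q q n)⁻¹ := by
  simp [recipQFact]

theorem recipQFact_of_neg (q : ℂ) {k : ℤ} (hk : k < 0) : recipQFact q k = 0 := by
  simp [recipQFact, hk]

/-- Extension by zero keeps this recurrence valid for every integer: at k = -1 the factor 1 - q^0
vanishes. Later index shifts therefore need no case split. -/
theorem recipQFact_step {q : ℂ} (hq : ‖q‖ < 1) (k : ℤ) :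
    recipQFact q k = (1 - q ^ (k + 1)) * recipQFact q (k + 1) := by
  rcases lt_trichotomy k (-1) with h | rfl | h
  · rw [recipQFact_of_neg q (by omega), recipQFact_of_neg q (by omega), mul_zero]
  · simp [recipQFact]
  · obtain ⟨n, rfl⟩ := Int.eq_ofNat_of_zero_le (show 0 ≤ k by omega)
    have h1 := qPoch_self_ne_zero hq (n + 1)
    have h2 := qPoch_self_ne_zero hq n
    rw [show ((n : ℤ) + 1) = ((n + 1 : ℕ) : ℤ) by push_cast; ring, recipQFact_natCast,
      recipQFact_natCast, zpow_natCast]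
    have h3 := qPoch_succ q q n
    rw [← pow_succ'] at h3
    field_simp
    rw [h3]

theorem exists_norm_recipQFact_le {q : ℂ} (hq : ‖q‖ < 1) :
    ∃ K : ℝ, 0 < K ∧ ∀ k, ‖recipQFact q k‖ ≤ K := by
  have ht := (tendsto_qPoch q hq).inv₀ (qPochInf_self_ne_zero hq)
  obtain ⟨K, hK, h⟩ := (Metric.isBounded_range_of_tendsto _ ht).exists_pos_norm_le
  refine ⟨K, hK, fun k => ?_⟩
  unfold recipQFact
  split_ifs
  · exact h _ ⟨k.toNat, rfl⟩
  · simpa using hK.le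

theorem tendsto_recipQFact {q : ℂ} (hq : ‖q‖ < 1) (c : ℤ) :
    Tendsto (fun n : ℕ => recipQFact q (n + c)) atTop (𝓝 (qPochInf q q)⁻¹) := by
  have ht := (tendsto_qPoch q hq).inv₀ (qPochInf_self_ne_zero hq)
  have h1 : Tendsto (fun n : ℕ => ((n : ℤ) + c).toNat) atTop atTop := by
    refine tendsto_atTop.mpr fun b => ?_
    filter_upwards [eventually_ge_atTop (b + c.natAbs)] with n hn
    omega
  refine (ht.comp h1).congr' ?_
  filter_upwards [eventually_ge_atTop c.natAbs] with n hn
  simp [recipQFact, show 0 ≤ (n : ℤ) + c by omega]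

/-! ### Gaussian binomials and the finite q-binomial theorem -/

theorem qBinom_eq_recipQFact {q : ℂ} (hq0 : q ≠ 0) (hq : ‖q‖ < 1) (n : ℕ) (k : ℤ) :
    qBinom q n k = qPoch q q n * recipQFact q k * recipQFact q (n - k) := by
  rcases lt_or_ge k 0 with h | h
  · simp [qBinom, recipQFact, not_le.mpr h]
  · obtain ⟨k, rfl⟩ := Int.eq_ofNat_of_zero_le h
    rcases lt_or_ge n k with h1 | h1
    · rw [qBinom_eq_zero hq0 h1, recipQFact_of_neg q (show (n : ℤ) - k < 0 by omega), mul_zero]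
    · rw [qBinom_eq hq h1, ← Nat.cast_sub h1, recipQFact_natCast, recipQFact_natCast]
      field_simp

theorem choose_two_succ_cast (k : ℕ) : (k + 1).choose 2 = k.choose 2 + k := by
  rw [Nat.choose_succ_succ' k 1, Nat.choose_one_right, add_comm]

theorem qBinom_pascal {q : ℂ} (hq0 : q ≠ 0) (hq : ‖q‖ < 1) (n : ℕ) (k : ℤ) :
    qBinom q ((n + 1 : ℕ) : ℤ) k = qBinom q n k + q ^ (n + 1 - k) * qBinom q n (k - 1) := by
  simp only [qBinom_eq_recipQFact hq0 hq]
  have h1 := recipQFact_step hq (k - 1)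
  have h2 := recipQFact_step hq (n - k)
  have h3 := qPoch_succ q q n
  rw [← pow_succ'] at h3
  rw [sub_add_cancel] at h1
  rw [show (((n + 1 : ℕ) : ℤ) - k) = n - k + 1 by push_cast; ring, h3,
    show (n : ℤ) - (k - 1) = n - k + 1 by ring, h1, h2,
    show (n : ℤ) + 1 - k = n - k + 1 by ring]
  have h4 : q ^ ((n : ℤ) - k + 1) * q ^ k = q ^ (n + 1) := by
    rw [← zpow_add₀ hq0, ← zpow_natCast]; congr 1; push_cast; ring
  linear_combination (qPoch q q n * recipQFact q k * recipQFact q (n - k + 1)) * h4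

/-- The finite `q`-binomial theorem. -/
theorem sum_qBinom_mul_pow {q : ℂ} (hq0 : q ≠ 0) (hq : ‖q‖ < 1) (x : ℂ) (l : ℕ) :
    ∑ k ∈ range (l + 1), qBinom q l k * ((-1) ^ k * q ^ (k.choose 2) * x ^ k) = qPoch x q l := by
  induction l with
  | zero => simp [qBinom]
  | succ l ih =>
    rw [qPoch_succ, ← ih, mul_sub, mul_one]
    have h0 : qBinom q l ((l + 1 : ℕ) : ℤ) = 0 := qBinom_eq_zero hq0 (Nat.lt_succ_self l)
    simp only [qBinom_pascal hq0 hq, add_mul, sum_add_distrib]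
    rw [sum_range_succ, h0, zero_mul, add_zero, sub_eq_add_neg]
    congr 1
    rw [sum_range_succ']
    have h1 : qBinom q l (((0 : ℕ) : ℤ) - 1) = 0 := by simp [qBinom]
    rw [h1, mul_zero, zero_mul, add_zero, sum_mul, ← sum_neg_distrib]
    refine sum_congr rfl fun k hk => ?_
    have hk' : k ≤ l := by simpa [Nat.lt_succ_iff] using hk
    rw [show (((k + 1 : ℕ) : ℤ) - 1) = k by push_cast; ring, choose_two_succ_cast,
      show ((l : ℤ) + 1 - ((k + 1 : ℕ) : ℤ)) = ((l - k : ℕ) : ℤ) by omega, zpow_natCast]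
    have h2 : q ^ l = q ^ (l - k) * q ^ k := by rw [← pow_add]; congr 1; omega
    rw [h2]; ring

theorem summable_pow_choose_mul_pow {ρ : ℝ} (h0 : 0 < ρ) (h1 : ρ < 1) {y : ℝ} (hy : 0 < y) :
    Summable fun r : ℕ => ρ ^ (r.choose 2) * y ^ r := by
  refine summable_of_ratio_test_tendsto_lt_one (l := 0) one_pos
    (Eventually.of_forall fun n => by positivity) ?_
  have h := (tendsto_pow_atTop_nhds_zero_of_lt_one h0.le h1).mul_const y
  rw [zero_mul] at h
  refine h.congr fun n => ?_
  rw [Real.norm_of_nonneg (by positivity), Real.norm_of_nonneg (by positivity),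
    choose_two_succ_cast]
  field_simp
  ring

/-! ### A limiting q-Gauss sum -/

section QGauss

variable {p : ℂ}

/-- The `r`-th term of the limiting case of the `q`-Gauss sum. -/
noncomputable def gaussTerm (p a x : ℂ) (M r : ℕ) : ℂ :=
  qPoch a p r * ((-1) ^ r * p ^ (r.choose 2) * x ^ r) * recipQFact p r * recipQFact p (M + r : ℕ)

theorem exists_norm_gaussTerm_le (hp : ‖p‖ < 1) (a : ℂ) :
    ∃ K : ℝ, 0 < K ∧ ∀ x M r, ‖gaussTerm p a x M r‖ ≤ K * (‖p‖ ^ (r.choose 2) * ‖x‖ ^ r) := by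
  obtain ⟨K, hK, h⟩ := exists_norm_qPoch_le a hp
  obtain ⟨L, hL, h'⟩ := exists_norm_recipQFact_le hp
  refine ⟨K * L * L, by positivity, fun x M r => ?_⟩
  simp only [gaussTerm, norm_mul, norm_pow, norm_neg, norm_one, one_pow, one_mul]
  calc _ ≤ K * (‖p‖ ^ (r.choose 2) * ‖x‖ ^ r) * L * L := by gcongr <;> simp [h, h']
    _ = _ := by ring

theorem summable_gaussTerm (hp0 : p ≠ 0) (hp : ‖p‖ < 1) (a : ℂ) {x : ℂ} (hx : x ≠ 0) (M : ℕ) :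
    Summable (gaussTerm p a x M) := by
  obtain ⟨K, hK, h⟩ := exists_norm_gaussTerm_le hp a
  exact .of_norm_bounded ((summable_pow_choose_mul_pow (norm_pos_iff.mpr hp0) hp
    (norm_pos_iff.mpr hx)).mul_left K) (h x M)

/-- Telescoping certificate for the step (x, M) → (xp, M+1). The boundary term at r = 0 dies because
of the factor 1 - p^0. The step preserves the relation between a, x and M, so it can be iterated. -/
theorem gaussTerm_sub (hp : ‖p‖ < 1) {a x : ℂ} {M : ℕ} (hax : a * x = p ^ (M + 1)) (r : ℕ) :
    gaussTerm p a x M r - (1 - x) * gaussTerm p a (x * p) (M + 1) r =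
      gaussTerm p a x M r * (1 - p ^ r) - gaussTerm p a x M (r + 1) * (1 - p ^ (r + 1)) := by
  have h1 := recipQFact_step hp (r : ℤ)
  have h2 := recipQFact_step hp ((M + r : ℕ) : ℤ)
  have e1 : (r : ℤ) + 1 = (r + 1 : ℕ) := by push_cast; ring
  have e2 : ((M + r : ℕ) : ℤ) + 1 = (M + 1 + r : ℕ) := by push_cast; ring
  rw [e1, zpow_natCast] at h1
  rw [e2, zpow_natCast] at h2
  have h3 : p ^ (M + 1 + r) = a * x * p ^ r := by rw [hax, pow_add]
  rw [h3] at h2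
  simp only [gaussTerm, qPoch_succ, choose_two_succ_cast, show M + (r + 1) = M + 1 + r by ring,
    h1, h2, pow_succ, pow_add, mul_pow]
  ring

theorem tsum_gaussTerm_step (hp0 : p ≠ 0) (hp : ‖p‖ < 1) {a x : ℂ} (hx : x ≠ 0) {M : ℕ}
    (hax : a * x = p ^ (M + 1)) :
    ∑' r, gaussTerm p a x M r = (1 - x) * ∑' r, gaussTerm p a (x * p) (M + 1) r := by
  have s1 := summable_gaussTerm hp0 hp a hx M
  have s2 := summable_gaussTerm hp0 hp a (mul_ne_zero hx hp0) (M + 1)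
  rw [← sub_eq_zero, ← tsum_mul_left, ← s1.tsum_sub (s2.mul_left _)]
  have h1 := (s1.sub (s2.mul_left (1 - x))).hasSum.tendsto_sum_nat
  refine tendsto_nhds_unique h1 ?_
  have h2 : Tendsto (fun n : ℕ => 0 - gaussTerm p a x M n * (1 - p ^ n)) atTop (𝓝 0) := by
    have := (s1.tendsto_atTop_zero.mul
      ((tendsto_pow_atTop_nhds_zero_of_norm_lt_one hp).const_sub 1)).const_sub 0
    simpa using this
  refine h2.congr fun n => ?_
  simp only [gaussTerm_sub hp hax]
  rw [sum_range_sub']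
  simp

theorem tsum_gaussTerm_iterate (hp0 : p ≠ 0) (hp : ‖p‖ < 1) {a x : ℂ} (hx : x ≠ 0) {M : ℕ}
    (hax : a * x = p ^ (M + 1)) (N : ℕ) :
    ∑' r, gaussTerm p a x M r = qPoch x p N * ∑' r, gaussTerm p a (x * p ^ N) (M + N) r := by
  induction N with
  | zero => simp
  | succ N ih =>
    rw [ih, tsum_gaussTerm_step hp0 hp (x := x * p ^ N) (mul_ne_zero hx (pow_ne_zero _ hp0))
      (by rw [← mul_assoc, hax]; ring), qPoch_succ, pow_succ]
    simp only [mul_assoc, add_assoc]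

/-- A limiting case of the `q`-Gauss sum. -/
theorem tsum_gaussTerm (hp0 : p ≠ 0) (hp : ‖p‖ < 1) {a x : ℂ} (hx : x ≠ 0) {M : ℕ}
    (hax : a * x = p ^ (M + 1)) :
    ∑' r, gaussTerm p a x M r = qPochInf x p * (qPochInf p p)⁻¹ := by
  refine tendsto_nhds_unique (tendsto_const_nhds.congr (tsum_gaussTerm_iterate hp0 hp hx hax))
    ((tendsto_qPoch x hp).mul ?_)
  obtain ⟨K, hK, h⟩ := exists_norm_gaussTerm_le hp a
  have hpow := tendsto_pow_atTop_nhds_zero_of_norm_lt_one hp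
  -- As N → ∞ the argument x p^N tends to 0. The limit keeps the factor (x * 0)^r, so only r = 0
  -- survives.
  have key := tendsto_tsum_of_dominated_convergence (𝓕 := atTop)
    (f := fun N r => gaussTerm p a (x * p ^ N) (M + N) r)
    (g := fun r => qPoch a p r * ((-1) ^ r * p ^ (r.choose 2) * (x * 0) ^ r) * recipQFact p r
      * (qPochInf p p)⁻¹)
    ((summable_pow_choose_mul_pow (norm_pos_iff.mpr hp0) hp (norm_pos_iff.mpr hx)).mul_left K)
    (fun r => ?_) (Eventually.of_forall fun N r => ?_)
  · rw [tsum_eq_single 0 (fun r hr => by simp [hr])] at key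
    simpa [recipQFact] using key
  · refine (((((hpow.const_mul x).pow r).const_mul _).const_mul _).mul_const _).mul ?_
    refine (tendsto_recipQFact hp (M + r)).congr fun N => ?_
    congr 1; push_cast; ring
  · refine (h _ _ _).trans ?_
    have : ‖x * p ^ N‖ ≤ ‖x‖ := by
      rw [norm_mul, norm_pow]
      exact mul_le_of_le_one_right (norm_nonneg _) (pow_le_one₀ (norm_nonneg _) hp.le)
    gcongr

end QGauss

/-! ### The conjugate Bailey pair -/

theorem norm_sq_lt_one {q : ℂ} (hq : ‖q‖ < 1) : ‖q ^ 2‖ < 1 := by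
  rw [norm_pow]; exact pow_lt_one₀ (norm_nonneg _) hq two_ne_zero

theorem one_add_zpow_ne_zero {q : ℂ} (hq : ‖q‖ < 1) {k : ℤ} (hk : k ≠ 0) :
    1 + q ^ k ≠ 0 := by
  intro h
  have h1 : ‖q‖ ^ k = 1 := by
    rw [← norm_zpow, show q ^ k = -1 by linear_combination h]; simp
  exact hk ((zpow_eq_one_iff_right₀ (norm_nonneg _) hq.ne).mp h1)

/-- The constant `(-q; q²)_∞ / (q²; q²)_∞`. -/
noncomputable def baileyConst (q : ℂ) : ℂ := qPochInf (-q) (q ^ 2) * (qPochInf (q ^ 2) (q ^ 2))⁻¹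

/-- The conjugate Bailey pair sum relative to `q²` in base `q²`. -/
noncomputable def conjTerm (q : ℂ) (s : ℤ) (n : ℕ) : ℂ :=
  q ^ (n * (n + 2)) * qPoch (-q) (q ^ 2) n *
    (recipQFact (q ^ 2) (n - s) * recipQFact (q ^ 2) (n + s + 1))

/-- The terms vanish for n < s, so the series starts at n = s. The signs in a = -q^(2s+1) and x =
-q^(2s+3) cancel the alternating sign, and a x = (q²)^(2s+2) is the q-Gauss condition with M = 2s+1.
-/
theorem conjTerm_add {q : ℂ} (s r : ℕ) :
    conjTerm q s (r + s) = q ^ (s * (s + 2)) * qPoch (-q) (q ^ 2) s *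
      gaussTerm (q ^ 2) (-q ^ (2 * s + 1)) (-q ^ (2 * s + 3)) (2 * s + 1) r := by
  have h2 : 2 * r.choose 2 + r = r * r := by
    have := Nat.choose_two_right r
    have h3 : 2 ∣ r * (r - 1) := (Nat.even_mul_pred_self r).two_dvd
    rcases r with _ | r
    · simp
    · simp only [Nat.add_sub_cancel] at *
      have : 2 * (r + 1).choose 2 = (r + 1) * r := by omega
      rw [this]; ring
  have h1 : q ^ ((r + s) * (r + s + 2)) =
      q ^ (s * (s + 2)) * ((q ^ 2) ^ r.choose 2 * (q ^ (2 * s + 3)) ^ r) := by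
    rw [← pow_mul, ← pow_mul, ← pow_add, ← pow_add]
    congr 1
    linear_combination -h2
  have h3 : -q * (q ^ 2) ^ s = -q ^ (2 * s + 1) := by ring
  have h4 : ((-1 : ℂ)) ^ r * (-1) ^ r = 1 := by rw [← mul_pow]; simp
  rw [conjTerm, h1, add_comm r s, qPoch_add, h3, gaussTerm, neg_pow (q ^ (2 * s + 3)),
    show (((s + r : ℕ) : ℤ) - s) = r by push_cast; ring,
    show (((s + r : ℕ) : ℤ) + s + 1) = (2 * s + 1 + r : ℕ) by push_cast; ring]
  linear_combination (-(q ^ (s * (s + 2)) * qPoch (-q) (q ^ 2) s * qPoch (-q ^ (2 * s + 1)) (q ^ 2) r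
    * (q ^ 2) ^ r.choose 2 * (q ^ (2 * s + 3)) ^ r * recipQFact (q ^ 2) r *
      recipQFact (q ^ 2) (2 * s + 1 + r : ℕ))) * h4

theorem hasSum_conjTerm_nat {q : ℂ} (hq0 : q ≠ 0) (hq : ‖q‖ < 1) (s : ℕ) :
    HasSum (conjTerm q s) (baileyConst q * (q ^ (s * (s + 2)) / (1 + q ^ (2 * s + 1)))) := by
  have hp0 : q ^ 2 ≠ 0 := pow_ne_zero _ hq0
  have hp := norm_sq_lt_one hq
  have hx : -q ^ (2 * s + 3) ≠ 0 := neg_ne_zero.mpr (pow_ne_zero _ hq0)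
  have h1 := (summable_gaussTerm hp0 hp (-q ^ (2 * s + 1)) hx (2 * s + 1)).hasSum
  rw [tsum_gaussTerm hp0 hp hx (by ring)] at h1
  have h2 := h1.mul_left (q ^ (s * (s + 2)) * qPoch (-q) (q ^ 2) s)
  simp only [← conjTerm_add] at h2
  refine ((add_left_injective s).hasSum_iff (f := conjTerm q s) fun n hn => ?_).mp ?_
  · have : n < s := by
      by_contra h
      exact hn ⟨n - s, by simp; omega⟩
    rw [conjTerm, recipQFact_of_neg _ (by omega), zero_mul, mul_zero]
  · change HasSum (fun i => conjTerm q s (i + s)) _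
    refine (congrArg (HasSum _) ?_).mpr h2
    have h3 := qPochInf_eq_mul (-q) hp (s + 1)
    have h4 : -q * (q ^ 2) ^ (s + 1) = -q ^ (2 * s + 3) := by ring
    have h5 : 1 - -q * (q ^ 2) ^ s = 1 + q ^ (2 * s + 1) := by ring
    have h6 : 1 + q ^ (2 * s + 1) ≠ 0 := by
      exact_mod_cast one_add_zpow_ne_zero hq (k := ((2 * s + 1 : ℕ) : ℤ)) (by omega)
    rw [qPoch_succ, h4, h5] at h3
    rw [baileyConst, h3]
    field_simp

theorem hasSum_conjTerm {q : ℂ} (hq0 : q ≠ 0) (hq : ‖q‖ < 1) (s : ℤ) :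
    HasSum (conjTerm q s) (baileyConst q * (q ^ (s * (s + 2)) / (1 + q ^ (2 * s + 1)))) := by
  rcases le_or_gt 0 s with h | h
  · obtain ⟨s, rfl⟩ := Int.eq_ofNat_of_zero_le h
    exact_mod_cast hasSum_conjTerm_nat hq0 hq s
  · obtain ⟨t, rfl⟩ : ∃ t : ℕ, s = -1 - t := ⟨(-1 - s).toNat, by omega⟩
    have h1 := hasSum_conjTerm_nat hq0 hq t
    -- The reflection s → -1 - s swaps the two reciprocal factorials, which reduces negative s to
    -- the previous case.
    have h2 : conjTerm q t = conjTerm q (-1 - t) := by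
      funext n
      simp only [conjTerm]
      rw [show (n : ℤ) - (-1 - t) = n + t + 1 by ring, show (n : ℤ) + (-1 - t) + 1 = n - t by ring,
        mul_comm (recipQFact _ ((n : ℤ) - t))]
    rw [h2] at h1
    convert h1 using 2
    have h6 : 1 + q ^ (2 * t + 1) ≠ 0 := by
      exact_mod_cast one_add_zpow_ne_zero hq (k := ((2 * t + 1 : ℕ) : ℤ)) (by omega)
    have h7 : 1 + q ^ (2 * (-1 - (t : ℤ)) + 1) ≠ 0 := one_add_zpow_ne_zero hq (by omega)
    rw [div_eq_div_iff h7 h6, mul_one_add, mul_one_add, ← zpow_natCast q (t * (t + 2)),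
      ← zpow_natCast q (2 * t + 1), ← zpow_add₀ hq0, ← zpow_add₀ hq0, add_comm]
    congr 2 <;> push_cast <;> ring

/-! ### Differences of Bailey terms -/

theorem two_mul_choose2 (s : ℤ) : 2 * choose2 s = s * (s - 1) :=
  Int.mul_ediv_cancel' (Int.even_mul_pred_self s).two_dvd

/-- The summand of the Bailey transform at the frequency `s`. -/
noncomputable def baileyTerm (q : ℂ) (n : ℕ) (s : ℤ) : ℂ :=
  q ^ (n * (n + 2)) * qPoch (-q) (q ^ 2) n / (1 + q ^ (2 * n)) * (q ^ (s ^ 2) * (q ^ s + q ^ (-s)))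
    * (recipQFact (q ^ 2) (n - s) * recipQFact (q ^ 2) (n + s))

theorem one_add_pow_two_mul_ne_zero {q : ℂ} (hq : ‖q‖ < 1) (n : ℕ) : 1 + q ^ (2 * n) ≠ 0 := by
  rcases n with _ | n
  · norm_num
  · exact_mod_cast one_add_zpow_ne_zero hq (k := ((2 * (n + 1) : ℕ) : ℤ)) (by omega)

/-- Over the common factor 1/((q²;q²)_(n-s) (q²;q²)_(n+s+1)) the numerator factors as 1 + q^(2n)
times a quantity free of n, so the denominator of `baileyTerm` cancels. -/
theorem baileyTerm_sub_succ {q : ℂ} (hq0 : q ≠ 0) (hq : ‖q‖ < 1) (n : ℕ) (s : ℤ) :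
    baileyTerm q n s - baileyTerm q n (s + 1) =
      q ^ (s ^ 2 + s) * (q ^ (-2 * s) - q ^ (2 * s + 2)) * conjTerm q s n := by
  have hp := norm_sq_lt_one hq
  have h1 := recipQFact_step hp (n + s)
  have h2 := recipQFact_step hp (n - s - 1)
  rw [sub_add_cancel] at h2
  have hn := one_add_pow_two_mul_ne_zero hq n
  have hX : q ^ s ≠ 0 := zpow_ne_zero _ hq0
  have e1 : q ^ ((s + 1) ^ 2) = q ^ (s ^ 2) * (q ^ s) ^ 2 * q := by
    rw [show (s + 1) ^ 2 = s ^ 2 + (s + s + 1) by ring, zpow_add₀ hq0, zpow_add_one₀ hq0,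
      zpow_add₀ hq0]; ring
  have e2 : (q ^ 2) ^ ((n : ℤ) + s + 1) = (q ^ n) ^ 2 * (q ^ s) ^ 2 * q ^ 2 := by
    rw [zpow_add_one₀ (pow_ne_zero _ hq0), zpow_add₀ (pow_ne_zero _ hq0), zpow_natCast,
      ← pow_mul, ← pow_mul, mul_comm 2 n, ← zpow_natCast q 2, ← zpow_mul, ← zpow_natCast (q ^ s),
      ← zpow_mul, mul_comm s]
  have e3 : (q ^ 2) ^ ((n : ℤ) - s) = (q ^ n) ^ 2 / (q ^ s) ^ 2 := by
    rw [zpow_sub₀ (pow_ne_zero _ hq0), zpow_natCast,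
      ← pow_mul, ← pow_mul, mul_comm 2 n, ← zpow_natCast q 2, ← zpow_mul, ← zpow_natCast (q ^ s),
      ← zpow_mul, mul_comm s]
  have e4 : q ^ (-2 * s) = ((q ^ s) ^ 2)⁻¹ := by
    rw [← zpow_natCast (q ^ s), ← zpow_mul, ← zpow_neg]; congr 1; push_cast; ring
  have e5 : q ^ (2 * s + 2) = (q ^ s) ^ 2 * q ^ 2 := by
    rw [← zpow_natCast (q ^ s), ← zpow_mul, ← zpow_natCast q 2, ← zpow_add₀ hq0]
    congr 1; push_cast; ring
  rw [e2] at h1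
  rw [e3] at h2
  simp only [baileyTerm, conjTerm]
  rw [show (n : ℤ) - (s + 1) = n - s - 1 by ring, show (n : ℤ) + (s + 1) = n + s + 1 by ring, h1, h2,
    e1, e4, e5, zpow_neg, zpow_neg, zpow_add_one₀ hq0, zpow_add₀ hq0 (s ^ 2) s]
  rw [show q ^ (2 * n) = (q ^ n) ^ 2 by ring] at hn ⊢
  generalize q ^ (n * (n + 2)) = Y
  generalize q ^ n = N at hn ⊢
  field_simp
  ring

/-- The four-term theta combination `∑_{i<4} (-1)^i q^{binom(2t+1+i, 2)}`. -/
noncomputable def quarticTerm (q : ℂ) (t : ℤ) : ℂ :=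
  q ^ (t * (2 * t + 1)) * (1 - q ^ (2 * t + 1) + q ^ (4 * t + 3) - q ^ (6 * t + 6))

/-- Since binom(a,2) = binom(1-a,2), the reflection reverses the order of the four monomials, whose
signs alternate. -/
theorem quarticTerm_neg {q : ℂ} (hq0 : q ≠ 0) (t : ℤ) :
    quarticTerm q (-t - 2) = -quarticTerm q t := by
  simp only [quarticTerm, mul_sub, mul_add, mul_one, ← zpow_add₀ hq0]
  ring_nf

theorem hasSum_baileyTerm_sub_succ {q : ℂ} (hq0 : q ≠ 0) (hq : ‖q‖ < 1) (s : ℤ) :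
    HasSum (fun n => baileyTerm q n s - baileyTerm q n (s + 1))
      (baileyConst q * (q ^ (s * (2 * s + 1)) * (1 - q ^ (2 * s + 1)))) := by
  have h := (hasSum_conjTerm hq0 hq s).mul_left (q ^ (s ^ 2 + s) * (q ^ (-2 * s) - q ^ (2 * s + 2)))
  simp only [← baileyTerm_sub_succ hq0 hq] at h
  refine (congrArg (HasSum _) ?_).mpr h
  have h7 : 1 + q ^ (2 * s + 1) ≠ 0 := one_add_zpow_ne_zero hq (by omega)
  have e1 : q ^ (2 * s + 2) = q ^ (-2 * s) * (q ^ (2 * s + 1) * q ^ (2 * s + 1)) := by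
    rw [← zpow_add₀ hq0, ← zpow_add₀ hq0]; ring_nf
  have e2 : q ^ (s * (2 * s + 1)) = q ^ (s ^ 2 + s) * q ^ (-2 * s) * q ^ (s * (s + 2)) := by
    rw [← zpow_add₀ hq0, ← zpow_add₀ hq0]; ring_nf
  -- The factor 1 - q^(4s+2) contains 1 + q^(2s+1), which cancels the denominator of the conjugate
  -- sum.
  rw [e1, e2]
  generalize q ^ (2 * s + 1) = X at *
  generalize q ^ (-2 * s) = Y
  field_simp
  ring

theorem hasSum_baileyTerm_sub {q : ℂ} (hq0 : q ≠ 0) (hq : ‖q‖ < 1) (s : ℤ) :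
    HasSum (fun n => baileyTerm q n s - baileyTerm q n (s + 2))
      (baileyConst q * quarticTerm q s) := by
  have h := (hasSum_baileyTerm_sub_succ hq0 hq s).add (hasSum_baileyTerm_sub_succ hq0 hq (s + 1))
  simp only [sub_add_sub_cancel, add_assoc, one_add_one_eq_two] at h
  refine (congrArg (HasSum _) ?_).mpr h
  rw [← mul_add, quarticTerm]
  congr 1
  simp only [mul_sub, mul_add, mul_one, ← zpow_add₀ hq0]
  ring_nf

theorem exists_norm_baileyTerm_le {q : ℂ} (hq0 : q ≠ 0) (hq : ‖q‖ < 1) :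
    ∃ K : ℝ, 0 < K ∧ ∀ n s, ‖baileyTerm q n s‖ ≤ K * ‖q‖ ^ n := by
  have hp := norm_sq_lt_one hq
  obtain ⟨K, hK, h⟩ := exists_norm_qPoch_le (-q) hp
  obtain ⟨L, hL, h'⟩ := exists_norm_recipQFact_le hp
  have hpos : 0 < 1 - ‖q‖ := sub_pos.mpr hq
  refine ⟨K / (1 - ‖q‖) * (1 + 1) * (L * L), by positivity, fun n s => ?_⟩
  have h1 : 1 - ‖q‖ ≤ ‖1 + q ^ (2 * n)‖ := by
    rcases n with _ | n
    · norm_num; linarith [norm_nonneg q]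
    · have h2 : ‖q ^ (2 * (n + 1))‖ ≤ ‖q‖ := by
        rw [norm_pow]; exact pow_le_of_le_one (norm_nonneg _) hq.le (by omega)
      have h3 := norm_sub_norm_le (1 : ℂ) (-q ^ (2 * (n + 1)))
      rw [norm_neg, norm_one, sub_neg_eq_add] at h3
      linarith
  have h4 : ∀ k : ℤ, 0 ≤ k → ‖q ^ k‖ ≤ 1 := fun k hk => by
    rw [norm_zpow]; exact zpow_le_one₀ (norm_pos_iff.mpr hq0) hq.le hk
  have h5 : ‖q ^ (s ^ 2) * (q ^ s + q ^ (-s))‖ ≤ 1 + 1 := by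
    rw [mul_add, ← zpow_add₀ hq0, ← zpow_add₀ hq0]
    -- This makes both exponents s² ± s nonnegative, so the bound is uniform in s.
    have hs : |s| ≤ s ^ 2 := by
      rw [← sq_abs]; nlinarith [abs_nonneg s, Int.one_le_abs (z := s)]
    exact (norm_add_le _ _).trans (add_le_add (h4 _ (by linarith [neg_abs_le s]))
      (h4 _ (by linarith [le_abs_self s])))
  have h6 : ‖q ^ (n * (n + 2))‖ ≤ ‖q‖ ^ n := by
    rw [norm_pow]
    exact pow_le_pow_of_le_one (norm_nonneg _) hq.le (Nat.le_mul_of_pos_right _ (by omega))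
  simp only [baileyTerm, norm_mul _ (_ * recipQFact _ _), norm_mul (_ / _), norm_div,
    norm_mul _ (qPoch _ _ _), norm_mul (recipQFact _ _)]
  calc _ ≤ ‖q‖ ^ n * K / (1 - ‖q‖) * (1 + 1) * (L * L) := by
        gcongr <;> simp only [h, h']
    _ = _ := by ring

/-! ### Gaussian binomials as Bailey terms -/

theorem qBinom_neg_one_succ {p : ℂ} (hp0 : p ≠ 0) (hp : ‖p‖ < 1) (k : ℕ) :
    qBinom p (-1) (k + 1) = -p ^ (-(k : ℤ) - 1) * qBinom p (-1) k := by
  have h1 : (-1 - ((k : ℤ) + 1) + 1) = -(k : ℤ) - 1 := by ring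
  have h2 : (-1 - (k : ℤ) + 1) = -(k : ℤ) - 1 + 1 := by ring
  have h3 := qPoch_self_ne_zero hp k
  have h4 := one_sub_pow_ne_zero hp (Nat.succ_ne_zero k)
  rw [qBinom, if_pos (by omega), qBinom, if_pos (by omega), h1, h2, zpow_add_one₀ hp0,
    show ((k : ℤ) + 1).toNat = k + 1 by omega, Int.toNat_natCast, qPoch_succ', qPoch_succ p p,
    ← pow_succ', show -(k : ℤ) - 1 = -((k + 1 : ℕ) : ℤ) by push_cast; ring, zpow_neg, zpow_natCast]
  have h5 : p ^ (k + 1) ≠ 0 := pow_ne_zero _ hp0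
  rw [Nat.succ_eq_add_one] at h4
  field_simp
  ring

/-- For n ≥ 1 the numerators add up to (1 - q^(2(n+s))) + q^(2s)(1 - q^(2(n-s))) = (1 + q^(2s))(1 -
q^(2n)), and the denominator supplies 1 - q^(4n). -/
theorem qBinom_two_mul_sub_one {q : ℂ} (hq0 : q ≠ 0) (hq : ‖q‖ < 1) (n : ℕ) (s : ℤ) :
    (qBinom (q ^ 2) (2 * (n : ℤ) - 1) (n - s)
      + q ^ (2 * s) * qBinom (q ^ 2) (2 * (n : ℤ) - 1) (n - s - 1)) / qPoch (q ^ 2) (q ^ 2) (2 * n) =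
    (1 + q ^ (2 * s)) / (1 + q ^ (2 * n)) *
      (recipQFact (q ^ 2) (n - s) * recipQFact (q ^ 2) (n + s)) := by
  have hp := norm_sq_lt_one hq
  have hp0 : q ^ 2 ≠ 0 := pow_ne_zero _ hq0
  have hz : ∀ k : ℤ, (q ^ 2) ^ k = q ^ (2 * k) := fun k => by rw [zpow_mul]; norm_cast
  rcases n with _ | n
  · simp only [Nat.cast_zero, mul_zero, zero_sub, qPoch_zero, div_one, pow_zero, zero_add]
    rcases lt_trichotomy s 0 with h | rfl | h
    -- With upper index -1 and s < 0 neither binomial vanishes; the two terms cancel.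
    · obtain ⟨k, rfl⟩ : ∃ k : ℕ, s = -(k : ℤ) - 1 := ⟨(-s - 1).toNat, by omega⟩
      rw [recipQFact_of_neg _ h, show -(-(k : ℤ) - 1) = k + 1 by ring,
        qBinom_neg_one_succ hp0 hp, hz, add_sub_cancel_right]
      ring
    · simp [qBinom, recipQFact]
    · rw [recipQFact_of_neg (q ^ 2) (show -s < 0 by omega)]
      rw [qBinom, qBinom, if_neg (by omega), if_neg (by omega)]
      simp
  · have e : 2 * ((n + 1 : ℕ) : ℤ) - 1 = ((2 * n + 1 : ℕ) : ℤ) := by push_cast; ring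
    have h1 := recipQFact_step hp (n + s)
    have h2 := recipQFact_step hp (n - s)
    rw [e, qBinom_eq_recipQFact hp0 hp, qBinom_eq_recipQFact hp0 hp,
      show (((2 * n + 1 : ℕ) : ℤ) - ((n + 1 : ℕ) - s)) = n + s by push_cast; ring,
      show (((2 * n + 1 : ℕ) : ℤ) - ((n + 1 : ℕ) - s - 1)) = n + s + 1 by push_cast; ring,
      show (((n + 1 : ℕ) : ℤ) - s) = n - s + 1 by push_cast; ring,
      show (((n + 1 : ℕ) : ℤ) + s) = n + s + 1 by push_cast; ring, add_sub_cancel_right, h1, h2,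
      show 2 * (n + 1) = 2 * n + 1 + 1 by ring, qPoch_succ (q ^ 2) (q ^ 2) (2 * n + 1)]
    have h3 := qPoch_self_ne_zero hp (2 * n + 1)
    have h4 := one_add_pow_two_mul_ne_zero hq (n + 1)
    have h5 : 1 - q ^ (2 * (n + 1)) ≠ 0 := one_sub_pow_ne_zero hq (by omega)
    have h6 : 1 - q ^ 2 * (q ^ 2) ^ (2 * n + 1) =
      (1 - q ^ (2 * (n + 1))) * (1 + q ^ (2 * (n + 1))) := by ring
    have h7 : (q ^ 2) ^ ((n : ℤ) + s + 1) = q ^ (2 * (n + 1)) * q ^ (2 * s) := by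
      rw [hz, ← zpow_natCast, ← zpow_add₀ hq0]; congr 1; push_cast; ring
    have h8 : q ^ (2 * s) * (q ^ 2) ^ ((n : ℤ) - s + 1) = q ^ (2 * (n + 1)) := by
      rw [hz, ← zpow_natCast, ← zpow_add₀ hq0]; congr 1; push_cast; ring
    rw [h6, h7, show 2 * n + 1 + 1 = 2 * (n + 1) by ring]
    rw [div_mul_eq_mul_div, div_eq_div_iff (mul_ne_zero h3 (mul_ne_zero h5 h4)) h4]
    linear_combination (-(qPoch (q ^ 2) (q ^ 2) (2 * n + 1)) * recipQFact (q ^ 2) (n - s + 1) *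
      recipQFact (q ^ 2) (n + s + 1) * (1 + q ^ (2 * (n + 1)))) * h8

theorem weight_mul_qBinom {q : ℂ} (hq0 : q ≠ 0) (hq : ‖q‖ < 1) (n : ℕ) (s : ℤ) :
    q ^ (n * (n + 2)) * qPoch (-q) (q ^ 2) n / qPoch (q ^ 2) (q ^ 2) (2 * n) *
      (q ^ (2 * choose2 s) * (qBinom (q ^ 2) (2 * (n : ℤ) - 1) (n - s)
        + q ^ (2 * s) * qBinom (q ^ 2) (2 * (n : ℤ) - 1) (n - s - 1))) = baileyTerm q n s := by
  have h := qBinom_two_mul_sub_one hq0 hq n s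
  have e : q ^ (2 * choose2 s) * (1 + q ^ (2 * s)) = q ^ (s ^ 2) * (q ^ s + q ^ (-s)) := by
    rw [two_mul_choose2, mul_one_add, mul_add, ← zpow_add₀ hq0, ← zpow_add₀ hq0, ← zpow_add₀ hq0]
    ring_nf
  rw [baileyTerm, ← e]
  linear_combination (q ^ (n * (n + 2)) * qPoch (-q) (q ^ 2) n * q ^ (2 * choose2 s)) * h

theorem weight_mul_fourTerm {q : ℂ} (hq0 : q ≠ 0) (hq : ‖q‖ < 1) (n : ℕ) (s : ℤ) :
    q ^ (n * (n + 2)) * qPoch (-q) (q ^ 2) n / qPoch (q ^ 2) (q ^ 2) (2 * n) *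
      (q ^ (2 * choose2 s) * fourTerm q n s) = baileyTerm q n s - baileyTerm q n (s + 2) := by
  rw [← weight_mul_qBinom hq0 hq n s, ← weight_mul_qBinom hq0 hq n (s + 2), fourTerm,
    two_mul_choose2, two_mul_choose2]
  have e1 : q ^ ((s + 2) * (s + 2 - 1)) = q ^ (s * (s - 1)) * q ^ (4 * s + 2) := by
    rw [← zpow_add₀ hq0]; ring_nf
  have e2 : q ^ (6 * (s + 1)) = q ^ (4 * s + 2) * q ^ (2 * (s + 2)) := by
    rw [← zpow_add₀ hq0]; ring_nf
  rw [e1, e2, show (n : ℤ) - (s + 2) = n - s - 2 by ring, show (n : ℤ) - s - 2 - 1 = n - s - 3 by ring]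
  ring

theorem choose2_natCast (n : ℕ) : choose2 n = (n.choose 2 : ℕ) := by
  have h1 := two_mul_choose2 n
  rcases n with _ | n
  · simp [choose2]
  · have h3 : ((n + 1).choose 2 : ℤ) * 2 = (n + 1) * n := by
      rw [Nat.choose_two_right, Nat.add_sub_cancel]
      exact_mod_cast Nat.div_mul_cancel (Nat.even_mul_pred_self (n + 1)).two_dvd
    push_cast at h1 ⊢
    linarith

theorem choose2_one_sub (s : ℤ) : choose2 (1 - s) = choose2 s := by
  have h1 := two_mul_choose2 s
  have h2 := two_mul_choose2 (1 - s)
  linarith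

theorem choose2_succ (s : ℤ) : choose2 (s + 1) = choose2 s + s := by
  have h1 := two_mul_choose2 s
  have h2 := two_mul_choose2 (s + 1)
  linarith

theorem summable_zpow_choose2_mul_zpow {ρ : ℝ} (h0 : 0 < ρ) (h1 : ρ < 1) {y : ℝ} (hy : 0 < y) :
    Summable fun m : ℤ => ρ ^ choose2 m * y ^ m := by
  refine .of_nat_of_neg_add_one ?_ ?_
  · simpa only [choose2_natCast, zpow_natCast] using summable_pow_choose_mul_pow h0 h1 hy
  · refine ((summable_pow_choose_mul_pow h0 h1 (y := ρ ^ 2 / y) (by positivity)).mul_left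
      (ρ / y)).congr fun n => ?_
    rw [show -((n : ℤ) + 1) = 1 - ((n + 1 + 1 : ℕ) : ℤ) by push_cast; ring, choose2_one_sub,
      choose2_natCast, choose_two_succ_cast, choose_two_succ_cast, zpow_natCast,
      zpow_sub₀ hy.ne', zpow_one, zpow_natCast, div_pow]
    field_simp
    ring

/-! ### Infinite product identities -/

theorem qPoch_mul_qPoch_neg (q : ℂ) (n : ℕ) :
    qPoch q (q ^ 2) n * qPoch (-q) (q ^ 2) n = qPoch (q ^ 2) (q ^ 4) n := by
  simp only [qPoch, ← prod_mul_distrib]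
  exact prod_congr rfl fun i _ => by ring

theorem qPoch_mul_qPoch_sq (a q : ℂ) (n : ℕ) :
    qPoch a (q ^ 2) n * qPoch (a * q) (q ^ 2) n = qPoch a q (2 * n) := by
  induction n with
  | zero => simp
  | succ n ih =>
    rw [show 2 * (n + 1) = 2 * n + 1 + 1 by ring]
    simp only [qPoch_succ, ← ih]
    ring

theorem tendsto_qPoch_two_mul (a : ℂ) {q : ℂ} (hq : ‖q‖ < 1) :
    Tendsto (fun n => qPoch a q (2 * n)) atTop (𝓝 (qPochInf a q)) :=
  (tendsto_qPoch a hq).comp (tendsto_id.const_mul_atTop' two_pos)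

theorem norm_pow_four_lt_one {q : ℂ} (hq : ‖q‖ < 1) : ‖q ^ 4‖ < 1 := by
  rw [norm_pow]; exact pow_lt_one₀ (norm_nonneg _) hq four_ne_zero

theorem qPochInf_mul_qPochInf_neg {q : ℂ} (hq : ‖q‖ < 1) :
    qPochInf q (q ^ 2) * qPochInf (-q) (q ^ 2) = qPochInf (q ^ 2) (q ^ 4) := by
  have hp := norm_sq_lt_one hq
  refine tendsto_nhds_unique ((tendsto_qPoch q hp).mul (tendsto_qPoch (-q) hp)) ?_
  simpa only [qPoch_mul_qPoch_neg] using tendsto_qPoch (q ^ 2) (norm_pow_four_lt_one hq)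

theorem qPochInf_mul_qPochInf_sq (a : ℂ) {q : ℂ} (hq : ‖q‖ < 1) :
    qPochInf a (q ^ 2) * qPochInf (a * q) (q ^ 2) = qPochInf a q := by
  have hp := norm_sq_lt_one hq
  refine tendsto_nhds_unique ((tendsto_qPoch a hp).mul (tendsto_qPoch (a * q) hp)) ?_
  simpa only [qPoch_mul_qPoch_sq] using tendsto_qPoch_two_mul a hq

theorem qPochInf_sq_mul {q : ℂ} (hq : ‖q‖ < 1) :
    qPochInf (q ^ 2) (q ^ 4) * qPochInf (q ^ 4) (q ^ 4) = qPochInf (q ^ 2) (q ^ 2) := by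
  have h := qPochInf_mul_qPochInf_sq (q ^ 2) (norm_sq_lt_one hq)
  rwa [← pow_mul, ← pow_add] at h

theorem baileyConst_eq {q : ℂ} (hq : ‖q‖ < 1) :
    baileyConst q = qPochInf (q ^ 2) (q ^ 2) / (qPochInf q q * qPochInf (q ^ 4) (q ^ 4)) := by
  have h1 := qPochInf_mul_qPochInf_neg hq
  have h2 := qPochInf_mul_qPochInf_sq q hq
  rw [← sq] at h2
  have h3 := qPochInf_sq_mul hq
  have n1 := qPochInf_self_ne_zero hq
  have n2 := qPochInf_self_ne_zero (norm_sq_lt_one hq)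
  have n3 := qPochInf_self_ne_zero (norm_pow_four_lt_one hq)
  rw [baileyConst, ← div_eq_mul_inv, div_eq_div_iff n2 (mul_ne_zero n1 n3)]
  linear_combination (-qPochInf (-q) (q ^ 2) * qPochInf (q ^ 4) (q ^ 4)) * h2
    + qPochInf (q ^ 2) (q ^ 2) * qPochInf (q ^ 4) (q ^ 4) * h1 + qPochInf (q ^ 2) (q ^ 2) * h3

theorem baileyConst_ne_zero {q : ℂ} (hq : ‖q‖ < 1) : baileyConst q ≠ 0 := by
  rw [baileyConst_eq hq]
  exact div_ne_zero (qPochInf_self_ne_zero (norm_sq_lt_one hq))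
    (mul_ne_zero (qPochInf_self_ne_zero hq) (qPochInf_self_ne_zero (norm_pow_four_lt_one hq)))

/-! ### Finite support and the interchange of sums -/

theorem qBinom_pair_eq_zero {q : ℂ} (hq0 : q ≠ 0) (hq : ‖q‖ < 1) {n : ℕ} {s : ℤ}
    (h : s < -n ∨ n < s) :
    qBinom (q ^ 2) (2 * (n : ℤ) - 1) (n - s)
      + q ^ (2 * s) * qBinom (q ^ 2) (2 * (n : ℤ) - 1) (n - s - 1) = 0 := by
  have h1 := qBinom_two_mul_sub_one hq0 hq n s
  have h2 : recipQFact (q ^ 2) (n - s) * recipQFact (q ^ 2) (n + s) = 0 := by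
    rcases h with h | h
    · rw [recipQFact_of_neg _ (show (n : ℤ) + s < 0 by omega), mul_zero]
    · rw [recipQFact_of_neg _ (show (n : ℤ) - s < 0 by omega), zero_mul]
  rw [h2, mul_zero, div_eq_zero_iff] at h1
  exact h1.resolve_right (qPoch_self_ne_zero (norm_sq_lt_one hq) _)

theorem fourTerm_eq {q : ℂ} (hq0 : q ≠ 0) (n : ℕ) (s : ℤ) :
    fourTerm q n s = (qBinom (q ^ 2) (2 * (n : ℤ) - 1) (n - s)
      + q ^ (2 * s) * qBinom (q ^ 2) (2 * (n : ℤ) - 1) (n - s - 1)) -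
      q ^ (4 * s + 2) * (qBinom (q ^ 2) (2 * (n : ℤ) - 1) (n - (s + 2))
      + q ^ (2 * (s + 2)) * qBinom (q ^ 2) (2 * (n : ℤ) - 1) (n - (s + 2) - 1)) := by
  have e2 : q ^ (6 * (s + 1)) = q ^ (4 * s + 2) * q ^ (2 * (s + 2)) := by
    rw [← zpow_add₀ hq0]; ring_nf
  rw [fourTerm, e2, show (n : ℤ) - (s + 2) = n - s - 2 by ring,
    show (n : ℤ) - s - 2 - 1 = n - s - 3 by ring]
  ring

theorem support_innerTerm_finite {q : ℂ} (hq0 : q ≠ 0) (hq : ‖q‖ < 1) (l n : ℕ) :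
    (Function.support (innerTerm q l n)).Finite := by
  refine (Set.finite_Icc (-(n + l + 3 : ℤ)) (n + l)).subset fun m hm => ?_
  by_contra h
  refine hm (sum_eq_zero fun k hk => ?_)
  have hk' : k < l + 1 := mem_range.mp hk
  rw [Set.mem_Icc, not_and_or, not_le, not_le] at h
  rw [fourTerm_eq hq0, qBinom_pair_eq_zero hq0 hq (by omega), qBinom_pair_eq_zero hq0 hq (by omega)]
  simp

/-- The summand in `n` and `m` of the Bailey transform with shift `c`. -/
noncomputable def shiftedTerm (q : ℂ) (c : ℤ) (x : ℕ × ℤ) : ℂ :=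
  (-1) ^ x.2 * q ^ choose2 (x.2 + 1) *
    (baileyTerm q x.1 (2 * x.2 + c) - baileyTerm q x.1 (2 * x.2 + c + 2))

/-- The bound on `baileyTerm` decays in n uniformly in s, while the theta factor supplies the decay
in m. -/
theorem summable_shiftedTerm {q : ℂ} (hq0 : q ≠ 0) (hq : ‖q‖ < 1) (c : ℤ) :
    Summable (shiftedTerm q c) := by
  obtain ⟨K, hK, h⟩ := exists_norm_baileyTerm_le hq0 hq
  have hρ := norm_pos_iff.mpr hq0
  have h1 := ((summable_geometric_of_lt_one hρ.le hq).mul_left (2 * K)).mul_of_nonneg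
    (summable_zpow_choose2_mul_zpow hρ hq hρ) (fun n => by positivity) (fun m => by positivity)
  refine .of_norm_bounded h1 fun ⟨n, m⟩ => ?_
  have h2 : ‖baileyTerm q n (2 * m + c) - baileyTerm q n (2 * m + c + 2)‖ ≤ 2 * K * ‖q‖ ^ n :=
    (norm_sub_le _ _).trans (by linarith [h n (2 * m + c), h n (2 * m + c + 2)])
  simp only [shiftedTerm, norm_mul, norm_zpow, norm_neg, norm_one, one_zpow, one_mul]
  rw [choose2_succ, zpow_add₀ hρ.ne', mul_comm]
  gcongr

theorem hasSum_shiftedTerm_left {q : ℂ} (hq0 : q ≠ 0) (hq : ‖q‖ < 1) (c m : ℤ) :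
    HasSum (fun n : ℕ => shiftedTerm q c (n, m))
      (baileyConst q * ((-1) ^ m * q ^ choose2 (m + 1) * quarticTerm q (2 * m + c))) := by
  have h := (hasSum_baileyTerm_sub hq0 hq (2 * m + c)).mul_left ((-1) ^ m * q ^ choose2 (m + 1))
  rwa [mul_left_comm] at h

theorem hasSum_shiftedTerm_reindexed {q : ℂ} (hq0 : q ≠ 0) (hq : ‖q‖ < 1) (c k : ℤ) :
    HasSum (fun m : ℤ => (-1) ^ (m - k) * q ^ choose2 (m - k + 1) * quarticTerm q (2 * m + c))
      ((baileyConst q)⁻¹ * ∑' x, shiftedTerm q (2 * k + c) x) := by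
  have h1 := (summable_shiftedTerm hq0 hq (2 * k + c)).hasSum
  have h2 := ((Equiv.prodComm ℤ ℕ).hasSum_iff.mpr h1).prod_fiberwise
    (fun m => hasSum_shiftedTerm_left hq0 hq (2 * k + c) m)
  -- The shift m → m - k turns 2m + (2k + c) into 2m + c.
  have h3 := (Equiv.subRight k).hasSum_iff.mpr (h2.mul_left (baileyConst q)⁻¹)
  refine h3.congr_fun fun m => ?_
  rw [Function.comp_apply, inv_mul_cancel_left₀ (baileyConst_ne_zero hq), Equiv.subRight_apply,
    show 2 * (m - k) + (2 * k + c) = 2 * m + c by ring]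

theorem neg_one_zpow_sub_natCast (N : ℤ) (k : ℕ) :
    (-1 : ℂ) ^ (N - k) = (-1) ^ N * (-1) ^ k := by
  rw [zpow_sub₀ (by norm_num), zpow_natCast, div_eq_iff (pow_ne_zero _ (by norm_num)), mul_assoc,
    ← mul_pow]
  simp

theorem sum_qBinom_mul_theta {q : ℂ} (hq0 : q ≠ 0) (hq : ‖q‖ < 1) (l : ℕ) (N : ℤ) :
    ∑ k ∈ range (l + 1), qBinom q l k * ((-1) ^ (N - k) * q ^ choose2 (N - k + 1)) =
      (-1) ^ N * q ^ choose2 (N + 1) * qPoch (q ^ (-N)) q l := by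
  rw [← sum_qBinom_mul_pow hq0 hq, mul_sum]
  refine sum_congr rfl fun k _ => ?_
  have h1 : q ^ choose2 (N - k + 1) = q ^ choose2 (N + 1) * (q ^ k.choose 2 * (q ^ (-N)) ^ k) := by
    rw [← zpow_natCast q (k.choose 2), ← zpow_natCast (q ^ (-N)), ← zpow_mul, ← zpow_add₀ hq0,
      ← zpow_add₀ hq0, ← choose2_natCast]
    congr 1
    have h1 := two_mul_choose2 (N - k + 1)
    have h2 := two_mul_choose2 (N + 1)
    have h3 := two_mul_choose2 k
    linarith
  rw [h1, neg_one_zpow_sub_natCast]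
  ring

/-- Reversing the product (q^(-j-l);q)_l pulls out a sign and a power of q; this matches the half N
≥ l with the half N < 0. -/
theorem pow_choose_mul_qPoch_inv {q : ℂ} (hq0 : q ≠ 0) (j l : ℕ) :
    q ^ (j + l + 1).choose 2 * qPoch ((q ^ (j + l))⁻¹) q l =
      (-1) ^ l * q ^ (j + 1).choose 2 * qPoch (q ^ (j + 1)) q l := by
  induction l with
  | zero => simp
  | succ l ih =>
    have h : (q ^ (j + (l + 1)))⁻¹ * q = (q ^ (j + l))⁻¹ := by
      rw [← add_assoc, pow_succ]; field_simp
    rw [qPoch_succ', h, qPoch_succ, show j + (l + 1) + 1 = j + l + 1 + 1 by ring,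
      choose_two_succ_cast, pow_add]
    have h2 : q ^ (j + l + 1) * (1 - (q ^ (j + (l + 1)))⁻¹) = -(1 - q ^ (j + 1) * q ^ l) := by
      have : q ^ (j + l + 1) ≠ 0 := pow_ne_zero _ hq0
      rw [← add_assoc]
      field_simp
      ring
    linear_combination (q ^ (j + l + 1) * (1 - (q ^ (j + (l + 1)))⁻¹)) * ih
      + (-1) ^ l * q ^ (j + 1).choose 2 * qPoch (q ^ (j + 1)) q l * h2

/-- The bilateral series obtained after applying the `q`-binomial theorem. -/
noncomputable def bilateralTerm (q : ℂ) (l : ℕ) (N : ℤ) : ℂ :=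
  (-1) ^ N * q ^ choose2 (N + 1) * qPoch (q ^ (-N)) q l * quarticTerm q (2 * N - l)

theorem rhsTerm_eq (q : ℂ) (l j : ℕ) :
    rhsTerm q l j = (-1) ^ j * q ^ (j + 1).choose 2 * qPoch (q ^ (j + 1)) q l *
      quarticTerm q (2 * j + l) := by
  have e : (2 * (j : ℤ) + l) * (2 * (2 * j + l) + 1) =
    ((2 * j + l) * (4 * j + 2 * l + 1) : ℕ) := by push_cast; ring
  have e1 : 2 * (2 * (j : ℤ) + l) + 1 = (2 * (2 * j + l) + 1 : ℕ) := by push_cast; ring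
  have e2 : 4 * (2 * (j : ℤ) + l) + 3 = (4 * (2 * j + l) + 3 : ℕ) := by push_cast; ring
  have e3 : 6 * (2 * (j : ℤ) + l) + 6 = (6 * (2 * j + l) + 6 : ℕ) := by push_cast; ring
  rw [rhsTerm, quarticTerm, e, e1, e2, e3]
  simp only [zpow_natCast]
  ring

theorem bilateralTerm_neg {q : ℂ} (hq0 : q ≠ 0) (l j : ℕ) :
    bilateralTerm q l (-((j : ℤ) + 1)) = rhsTerm q l j := by
  have e1 : choose2 (-((j : ℤ) + 1) + 1) = ((j + 1).choose 2 : ℕ) := by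
    rw [← choose2_natCast, ← choose2_one_sub]; congr 1; push_cast; ring
  have e2 : 2 * -((j : ℤ) + 1) - l = -(2 * j + l) - 2 := by ring
  have e3 : (-1 : ℂ) ^ (-((j : ℤ) + 1)) = -(-1) ^ j := by
    rw [neg_add, zpow_add₀ (by norm_num), zpow_neg, zpow_natCast, ← inv_pow]; norm_num
  rw [bilateralTerm, rhsTerm_eq q, e1, e2, e3, quarticTerm_neg hq0, neg_neg, zpow_natCast,
    ← Nat.cast_succ, zpow_natCast]
  ring

theorem bilateralTerm_add {q : ℂ} (hq0 : q ≠ 0) (l j : ℕ) :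
    bilateralTerm q l (j + l : ℕ) = rhsTerm q l j := by
  have h := pow_choose_mul_qPoch_inv hq0 j l
  have h4 : ((-1 : ℂ)) ^ l * (-1) ^ l = 1 := by rw [← mul_pow]; simp
  rw [bilateralTerm, rhsTerm_eq q, ← Nat.cast_succ, choose2_natCast, zpow_natCast, zpow_natCast,
    zpow_neg, zpow_natCast, mul_assoc ((-1 : ℂ) ^ (j + l)), h, pow_add,
    show 2 * ((j + l : ℕ) : ℤ) - l = 2 * j + l by push_cast; ring]
  linear_combination ((-1) ^ j * q ^ (j + 1).choose 2 * qPoch (q ^ (j + 1)) q l *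
    quarticTerm q (2 * j + l)) * h4

theorem bilateralTerm_eq_zero {q : ℂ} (hq0 : q ≠ 0) {l n : ℕ} (h : n < l) :
    bilateralTerm q l n = 0 := by
  have : qPoch (q ^ (-(n : ℤ))) q l = 0 :=
    prod_eq_zero (mem_range.mpr h) (by rw [zpow_neg, zpow_natCast, inv_mul_cancel₀ (by positivity), sub_self])
  rw [bilateralTerm, this, mul_zero, zero_mul]

theorem summable_rhsTerm_of_bilateral {q : ℂ} (hq0 : q ≠ 0) {l : ℕ}
    (h : Summable (bilateralTerm q l)) : Summable (rhsTerm q l) := by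
  have hi : Function.Injective fun j : ℕ => -((j : ℤ) + 1) := fun a b hab => by
    simpa using hab
  exact (h.comp_injective hi).congr fun j => bilateralTerm_neg hq0 l j

theorem tsum_bilateralTerm {q : ℂ} (hq0 : q ≠ 0) {l : ℕ} (h : Summable (bilateralTerm q l)) :
    ∑' N, bilateralTerm q l N = 2 * ∑' j, rhsTerm q l j := by
  have h1 := (summable_rhsTerm_of_bilateral hq0 h).hasSum
  have h2 : HasSum (fun n : ℕ => bilateralTerm q l n) (∑' j, rhsTerm q l j) := by
    refine ((add_left_injective l).hasSum_iff (f := fun n : ℕ => bilateralTerm q l n)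
      fun n hn => ?_).mp (h1.congr_fun fun j => bilateralTerm_add hq0 l j)
    refine bilateralTerm_eq_zero hq0 ?_
    by_contra h
    exact hn ⟨n - l, by simp; omega⟩
  have h3 := h2.of_nat_of_neg_add_one (f := bilateralTerm q l)
    (h1.congr_fun fun j => bilateralTerm_neg hq0 l j)
  rw [h3.tsum_eq]; ring

theorem hasSum_bilateralTerm {q : ℂ} (hq0 : q ≠ 0) (hq : ‖q‖ < 1) (l : ℕ) :
    HasSum (bilateralTerm q l) ((baileyConst q)⁻¹ *
      ∑ k ∈ range (l + 1), qBinom q l k * ∑' x, shiftedTerm q (2 * k - l) x) := by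
  have h := hasSum_sum (s := range (l + 1)) fun (k : ℕ) _ =>
    (hasSum_shiftedTerm_reindexed hq0 hq (-l) k).mul_left (qBinom q l k)
  rw [mul_sum]
  refine (congrArg (HasSum _) (sum_congr rfl fun k _ => ?_)).mpr (h.congr_fun fun N => ?_)
  · rw [mul_left_comm, sub_eq_add_neg (2 * (k : ℤ))]
  · rw [bilateralTerm, ← sum_qBinom_mul_theta hq0 hq, sum_mul, ← sub_eq_add_neg]
    exact sum_congr rfl fun k _ => by ring

theorem lhsTerm_eq {q : ℂ} (hq0 : q ≠ 0) (hq : ‖q‖ < 1) (l n : ℕ) :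
    lhsTerm q l n =
      ∑' m : ℤ, ∑ k ∈ range (l + 1), qBinom q l k * shiftedTerm q (2 * k - l) (n, m) := by
  rw [lhsTerm, ← tsum_mul_left]
  refine tsum_congr fun m => ?_
  rw [innerTerm, mul_sum]
  refine sum_congr rfl fun k _ => ?_
  have h := weight_mul_fourTerm hq0 hq n (2 * m + 2 * k - l)
  rw [shiftedTerm, ← add_sub_assoc, ← h, zpow_add₀ hq0]
  ring

theorem hasSum_lhsTerm {q : ℂ} (hq0 : q ≠ 0) (hq : ‖q‖ < 1) (l : ℕ) :
    HasSum (lhsTerm q l)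
      (∑ k ∈ range (l + 1), qBinom q l k * ∑' x, shiftedTerm q (2 * k - l) x) := by
  have h := hasSum_sum (s := range (l + 1)) fun (k : ℕ) _ =>
    (summable_shiftedTerm hq0 hq (2 * k - l)).hasSum.mul_left (qBinom q l k)
  exact (h.prod_fiberwise fun n => (h.summable.prod_factor n).hasSum).congr_fun
    fun n => lhsTerm_eq hq0 hq l n

theorem summable_rhsTerm {q : ℂ} (hq0 : q ≠ 0) (hq : ‖q‖ < 1) (l : ℕ) : Summable (rhsTerm q l) :=
  summable_rhsTerm_of_bilateral hq0 (hasSum_bilateralTerm hq0 hq l).summable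

theorem hasSum_lhsTerm_eq {q : ℂ} (hq0 : q ≠ 0) (hq : ‖q‖ < 1) (l : ℕ) :
    HasSum (lhsTerm q l) (2 * qPochInf (q ^ 2) (q ^ 2) / (qPochInf q q * qPochInf (q ^ 4) (q ^ 4))
      * ∑' j : ℕ, rhsTerm q l j) := by
  have h1 := hasSum_bilateralTerm hq0 hq l
  have h2 := h1.tsum_eq
  rw [tsum_bilateralTerm hq0 h1.summable, eq_inv_mul_iff_mul_eq₀ (baileyConst_ne_zero hq),
    baileyConst_eq hq] at h2
  refine (congrArg (HasSum _) ?_).mpr (hasSum_lhsTerm hq0 hq l)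
  rw [← h2]; ring

/-! ### The Jacobi triple product -/

section JacobiTripleProduct

variable {p : ℂ}

/-- The term of the Gaussian form of the finite Jacobi triple product. -/
noncomputable def finiteThetaTerm (p z : ℂ) (N : ℕ) (m : ℤ) : ℂ :=
  qPoch p p (2 * N) * recipQFact p (N + m) * recipQFact p (N - m) *
    ((-1) ^ m * p ^ choose2 m * z ^ m)

theorem pow_choose_mul_qPoch_div (hp0 : p ≠ 0) {z : ℂ} (hz : z ≠ 0) (N : ℕ) :
    p ^ (N + 1).choose 2 * qPoch (z / p ^ N) p N = (-z) ^ N * qPoch (p / z) p N := by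
  induction N with
  | zero => simp
  | succ N ih =>
    have h : z / p ^ (N + 1) * p = z / p ^ N := by rw [pow_succ]; field_simp
    rw [qPoch_succ', h, qPoch_succ, choose_two_succ_cast (N + 1), pow_add, pow_succ (-z)]
    have h2 : p ^ (N + 1) * (1 - z / p ^ (N + 1)) = -z * (1 - p / z * p ^ N) := by
      field_simp
      ring
    linear_combination (p ^ (N + 1) * (1 - z / p ^ (N + 1))) * ih
      + (-z) ^ N * qPoch (p / z) p N * h2

theorem pow_choose_mul_qBinom_term (hp0 : p ≠ 0) (hp : ‖p‖ < 1) {z : ℂ} (hz : z ≠ 0) (N k : ℕ) :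
    p ^ (N + 1).choose 2 *
      (qBinom p (2 * N : ℕ) k * ((-1) ^ k * p ^ k.choose 2 * (z / p ^ N) ^ k)) =
    (-z) ^ N * finiteThetaTerm p z N (k - N) := by
  have h1 : p ^ choose2 (k - N) * p ^ (N * k) = p ^ (N + 1).choose 2 * p ^ k.choose 2 := by
    simp only [← zpow_natCast, ← choose2_natCast, ← zpow_add₀ hp0]
    congr 1
    have h1 := two_mul_choose2 (k - N)
    have h2 := two_mul_choose2 (N + 1)
    have h3 := two_mul_choose2 k
    push_cast
    linarith
  have h2 : z ^ N * z ^ ((k : ℤ) - N) = z ^ k := by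
    rw [← zpow_natCast, ← zpow_add₀ hz, ← zpow_natCast]; congr 1; ring
  have h3 : (-1 : ℂ) ^ N * (-1) ^ ((k : ℤ) - N) = (-1) ^ k := by
    rw [← zpow_natCast, ← zpow_add₀ (by norm_num), ← zpow_natCast]; congr 1; ring
  rw [finiteThetaTerm, qBinom_eq_recipQFact hp0 hp, neg_pow z, ← h3, div_pow, ← h2, ← pow_mul,
    show (N : ℤ) + (k - N) = k by ring,
    show (N : ℤ) - (k - N) = (2 * N : ℕ) - k by push_cast; ring]
  have : p ^ (N * k) ≠ 0 := pow_ne_zero _ hp0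
  field_simp
  linear_combination (-qPoch p p (2 * N) * recipQFact p k * recipQFact p ((2 * N : ℕ) - k)) * h1

/-- This is the q-binomial theorem of order 2N at z/p^N, recentred by k = N + m. The factors of
(z/p^N;p)_(2N) split into (z;p)_N and a reversed (p/z;p)_N. -/
theorem hasSum_finiteThetaTerm (hp0 : p ≠ 0) (hp : ‖p‖ < 1) {z : ℂ} (hz : z ≠ 0) (N : ℕ) :
    HasSum (finiteThetaTerm p z N) (qPoch z p N * qPoch (p / z) p N) := by
  have hi : Function.Injective fun k : ℕ => (k : ℤ) - N := fun a b hab => by simpa using hab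
  refine (hi.hasSum_iff fun m hm => ?_).mp ?_
  · have : (N : ℤ) + m < 0 := by
      by_contra h
      exact hm ⟨(N + m).toNat, by simp only; omega⟩
    rw [finiteThetaTerm, recipQFact_of_neg _ this]
    simp
  · have h0 : (-z) ^ N ≠ 0 := pow_ne_zero _ (neg_ne_zero.mpr hz)
    have h1 : ∀ k ∉ range (2 * N + 1), finiteThetaTerm p z N (k - N) = 0 := fun k hk => by
      rw [mem_range] at hk
      rw [finiteThetaTerm, recipQFact_of_neg p (show (N : ℤ) - (k - N) < 0 by omega)]
      simp
    refine (congrArg (HasSum _) ?_).mpr (hasSum_sum_of_ne_finset_zero h1)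
    refine mul_left_cancel₀ h0 ?_
    rw [mul_sum]
    refine Eq.trans ?_ (sum_congr rfl fun k _ => pow_choose_mul_qBinom_term hp0 hp hz N k)
    rw [← mul_sum, sum_qBinom_mul_pow hp0 hp, two_mul, qPoch_add,
      div_mul_cancel₀ _ (pow_ne_zero _ hp0)]
    linear_combination (-qPoch z p N) * pow_choose_mul_qPoch_div hp0 hz N

theorem hasSum_jacobi_triple_product (hp0 : p ≠ 0) (hp : ‖p‖ < 1) {z : ℂ} (hz : z ≠ 0) :
    HasSum (fun m : ℤ => (-1) ^ m * p ^ choose2 m * z ^ m)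
      (qPochInf z p * qPochInf (p / z) p * qPochInf p p) := by
  have hs := summable_zpow_choose2_mul_zpow (norm_pos_iff.mpr hp0) hp (norm_pos_iff.mpr hz)
  have hsum : Summable fun m : ℤ => (-1) ^ m * p ^ choose2 m * z ^ m :=
    .of_norm (hs.congr fun m => by simp)
  obtain ⟨K, hK, h⟩ := exists_norm_qPoch_le p hp
  obtain ⟨L, hL, h'⟩ := exists_norm_recipQFact_le hp
  have hP := qPochInf_self_ne_zero hp
  have key := tendsto_tsum_of_dominated_convergence (𝓕 := atTop)
    (f := finiteThetaTerm p z)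
    (g := fun m => qPochInf p p * (qPochInf p p)⁻¹ * (qPochInf p p)⁻¹ *
      ((-1) ^ m * p ^ choose2 m * z ^ m))
    (hs.mul_left (K * L * L)) (fun m => ?_) (Eventually.of_forall fun N m => ?_)
  · simp only [(hasSum_finiteThetaTerm hp0 hp hz _).tsum_eq, tsum_mul_left] at key
    have h1 := tendsto_nhds_unique key ((tendsto_qPoch z hp).mul (tendsto_qPoch (p / z) hp))
    refine (hsum.hasSum_iff).mpr ?_
    rw [← h1]
    field_simp
  · refine (((tendsto_qPoch_two_mul p hp).mul (tendsto_recipQFact hp m)).mul ?_).mul_const _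
    simpa only [sub_eq_add_neg] using tendsto_recipQFact hp (-m)
  · simp only [finiteThetaTerm, norm_mul, norm_zpow, norm_neg, norm_one, one_zpow, one_mul]
    gcongr <;> simp only [h, h']

end JacobiTripleProduct

/-! ### The case ℓ = 0: theta side -/

/-- The first and fourth monomials are the terms at j and -(j+1) of the theta series with z = q^11;
the second and third are those with z = q^15. -/
theorem rhsTerm_zero_eq {q : ℂ} (hq0 : q ≠ 0) (j : ℕ) :
    rhsTerm q 0 j =
      ((-1) ^ (j : ℤ) * (q ^ 17) ^ choose2 j * (q ^ 11) ^ (j : ℤ) +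
        (-1) ^ (-((j : ℤ) + 1)) * (q ^ 17) ^ choose2 (-((j : ℤ) + 1)) *
          (q ^ 11) ^ (-((j : ℤ) + 1))) -
      q * ((-1) ^ (j : ℤ) * (q ^ 17) ^ choose2 j * (q ^ 15) ^ (j : ℤ) +
        (-1) ^ (-((j : ℤ) + 1)) * (q ^ 17) ^ choose2 (-((j : ℤ) + 1)) *
          (q ^ 15) ^ (-((j : ℤ) + 1))) := by
  have e3 : (-1 : ℂ) ^ (-((j : ℤ) + 1)) = -(-1) ^ j := by
    rw [neg_add, zpow_add₀ (by norm_num), zpow_neg, zpow_natCast, ← inv_pow]; norm_num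
  have hz : ∀ (a : ℕ) (k : ℤ), (q ^ a) ^ k = q ^ (a * k) := fun a k => by
    rw [zpow_mul, zpow_natCast]
  have h1 := two_mul_choose2 j
  have h2 := two_mul_choose2 (-((j : ℤ) + 1))
  have h3 := two_mul_choose2 (j + 1)
  have hm : ∀ k : ℤ, q * q ^ k = q ^ (k + 1) := fun k => by rw [zpow_add_one₀ hq0, mul_comm]
  have s1 : q ^ (j + 1).choose 2 * q ^ ((2 * (j : ℤ)) * (2 * (2 * j) + 1)) =
      (q ^ 17) ^ choose2 j * (q ^ 11) ^ (j : ℤ) := by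
    rw [hz, hz, ← zpow_natCast q (Nat.choose _ _), ← choose2_natCast, ← zpow_add₀ hq0,
      ← zpow_add₀ hq0]
    congr 1; push_cast; linarith
  have s2 : q ^ (j + 1).choose 2 * q ^ ((2 * (j : ℤ)) * (2 * (2 * j) + 1)) *
      q ^ (2 * (2 * (j : ℤ)) + 1) = q * ((q ^ 17) ^ choose2 j * (q ^ 15) ^ (j : ℤ)) := by
    rw [hz, hz, ← zpow_natCast q (Nat.choose _ _), ← choose2_natCast, ← zpow_add₀ hq0,
      ← zpow_add₀ hq0, ← zpow_add₀ hq0, hm]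
    congr 1; push_cast; linarith
  have s3 : q ^ (j + 1).choose 2 * q ^ ((2 * (j : ℤ)) * (2 * (2 * j) + 1)) *
      q ^ (4 * (2 * (j : ℤ)) + 3) =
      q * ((q ^ 17) ^ choose2 (-((j : ℤ) + 1)) * (q ^ 15) ^ (-((j : ℤ) + 1))) := by
    rw [hz, hz, ← zpow_natCast q (Nat.choose _ _), ← choose2_natCast, ← zpow_add₀ hq0,
      ← zpow_add₀ hq0, ← zpow_add₀ hq0, hm]
    congr 1; push_cast; linarith
  have s4 : q ^ (j + 1).choose 2 * q ^ ((2 * (j : ℤ)) * (2 * (2 * j) + 1)) *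
      q ^ (6 * (2 * (j : ℤ)) + 6) =
      (q ^ 17) ^ choose2 (-((j : ℤ) + 1)) * (q ^ 11) ^ (-((j : ℤ) + 1)) := by
    rw [hz, hz, ← zpow_natCast q (Nat.choose _ _), ← choose2_natCast, ← zpow_add₀ hq0,
      ← zpow_add₀ hq0, ← zpow_add₀ hq0]
    congr 1; push_cast; linarith
  rw [rhsTerm_eq, qPoch_zero, quarticTerm, e3, zpow_natCast (-1 : ℂ), Nat.cast_zero, add_zero]
  linear_combination (-1) ^ j * (s1 - s2 + s3 - s4)

theorem tsum_rhsTerm_zero {q : ℂ} (hq0 : q ≠ 0) (hq : ‖q‖ < 1) :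
    ∑' j, rhsTerm q 0 j =
      qPochInf (q ^ 6) (q ^ 17) * qPochInf (q ^ 11) (q ^ 17) * qPochInf (q ^ 17) (q ^ 17)
        - q * (qPochInf (q ^ 2) (q ^ 17) * qPochInf (q ^ 15) (q ^ 17)
          * qPochInf (q ^ 17) (q ^ 17)) := by
  have hp0 : q ^ 17 ≠ 0 := pow_ne_zero _ hq0
  have hp : ‖q ^ 17‖ < 1 := by
    rw [norm_pow]; exact pow_lt_one₀ (norm_nonneg _) hq (by norm_num)
  have h1 := (hasSum_jacobi_triple_product hp0 hp (pow_ne_zero 11 hq0)).nat_add_neg_add_one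
  have h2 := (hasSum_jacobi_triple_product hp0 hp (pow_ne_zero 15 hq0)).nat_add_neg_add_one
  have e1 : q ^ 17 / q ^ 11 = q ^ 6 := by field_simp
  have e2 : q ^ 17 / q ^ 15 = q ^ 2 := by field_simp
  rw [((h1.sub (h2.mul_left q)).congr_fun fun j => rhsTerm_zero_eq hq0 j).tsum_eq, e1, e2]
  ring

/-! ### The case ℓ = 0: double sum -/

theorem baileyTerm_eq_zero {q : ℂ} {n : ℕ} {s : ℤ} (h : s < -n ∨ n < s) : baileyTerm q n s = 0 := by
  rcases h with h | h
  · rw [baileyTerm, recipQFact_of_neg (q ^ 2) (show (n : ℤ) + s < 0 by omega)]; simp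
  · rw [baileyTerm, recipQFact_of_neg (q ^ 2) (show (n : ℤ) - s < 0 by omega)]; simp

/-- Summation by parts: the coefficients of B_n(2m) coming from m and m - 1 combine into 1 + q^m. -/
theorem lhsTerm_zero_eq {q : ℂ} (hq0 : q ≠ 0) (hq : ‖q‖ < 1) (n : ℕ) :
    lhsTerm q 0 n = ∑' m : ℤ, (-1) ^ m * q ^ choose2 m * (1 + q ^ m) * baileyTerm q n (2 * m) := by
  have hfin : ∀ c : ℤ → ℂ, Summable fun m : ℤ => c m * baileyTerm q n (2 * m) := fun c =>
    summable_of_ne_finset_zero (s := Icc (-n : ℤ) n) fun m hm => by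
      rw [mem_Icc, not_and_or, not_le, not_le] at hm
      rw [baileyTerm_eq_zero (by omega), mul_zero]
  have h1 := (hfin fun m => (-1) ^ m * q ^ choose2 (m + 1)).hasSum
  have h2 := (hfin fun m => (-1) ^ m * q ^ choose2 m).hasSum
  have h3 := h1.add ((Equiv.addRight (1 : ℤ)).hasSum_iff.mpr h2)
  have h4 := h1.add h2
  rw [lhsTerm_eq hq0 hq]
  refine (h3.congr_fun fun m => ?_).tsum_eq.trans (h4.congr_fun fun m => ?_).tsum_eq.symm
  · rw [zero_add, sum_range_one, Function.comp_apply, Equiv.coe_addRight, shiftedTerm,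
      show (2 * ((0 : ℕ) : ℤ) - ((0 : ℕ) : ℤ)) = 0 by simp, add_zero,
      show 2 * m + 2 = 2 * (m + 1) by ring, zpow_add_one₀ (by norm_num : (-1 : ℂ) ≠ 0)]
    simp only [qBinom, Nat.cast_zero, le_refl, if_true, Int.toNat_zero, qPoch_zero]
    ring
  · rw [choose2_succ, zpow_add₀ hq0]; ring

/-- The summand of the double sum, for an arbitrary integer `m`. -/
noncomputable def doubleSummand (q : ℂ) (n : ℕ) (m : ℤ) : ℂ :=
  (-1) ^ m * q ^ ((n : ℤ) * (n + 2) + m * (9 * m - 5) / 2) * (1 + q ^ m)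
    / (qPoch q (q ^ 2) n * qPoch (q ^ 4) (q ^ 4) n) * qBinom (q ^ 2) (2 * (n : ℤ) - 1) (n - 2 * m)

theorem weight_eq {q : ℂ} (hq : ‖q‖ < 1) (n : ℕ) :
    qPoch (-q) (q ^ 2) n / qPoch (q ^ 2) (q ^ 2) (2 * n) =
      1 / (qPoch q (q ^ 2) n * qPoch (q ^ 4) (q ^ 4) n) := by
  have h1 := qPoch_mul_qPoch_neg q n
  have h2 := qPoch_mul_qPoch_sq (q ^ 2) (q ^ 2) n
  rw [← pow_mul, ← pow_add] at h2
  have h3 := qPoch_mul_qPoch_sq q q n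
  have n1 := qPoch_self_ne_zero (norm_sq_lt_one hq) (2 * n)
  have n2 := qPoch_self_ne_zero (norm_pow_four_lt_one hq) n
  have n3 : qPoch q (q ^ 2) n ≠ 0 := left_ne_zero_of_mul (h3 ▸ qPoch_self_ne_zero hq (2 * n))
  rw [div_eq_div_iff n1 (mul_ne_zero n3 n2), ← h2, ← h1]
  ring

/-- The symmetry [2n-1, k] = [2n-1, 2n-1-k] turns the second binomial of the pair into the first one
at -m. -/
theorem summand_eq_add {q : ℂ} (hq0 : q ≠ 0) (hq : ‖q‖ < 1) (n : ℕ) (m : ℤ) :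
    (-1) ^ m * q ^ choose2 m * (1 + q ^ m) * baileyTerm q (n + 1) (2 * m) =
      doubleSummand q (n + 1) m + doubleSummand q (n + 1) (-m) := by
  have hp0 : q ^ 2 ≠ 0 := pow_ne_zero _ hq0
  have hp := norm_sq_lt_one hq
  have hsymm : qBinom (q ^ 2) (2 * ((n + 1 : ℕ) : ℤ) - 1) ((n + 1 : ℕ) - 2 * -m) =
      qBinom (q ^ 2) (2 * ((n + 1 : ℕ) : ℤ) - 1) ((n + 1 : ℕ) - 2 * m - 1) := by
    rw [show 2 * ((n + 1 : ℕ) : ℤ) - 1 = (2 * n + 1 : ℕ) by push_cast; ring,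
      qBinom_eq_recipQFact hp0 hp, qBinom_eq_recipQFact hp0 hp, mul_right_comm]
    refine congrArg₂ _ (congrArg _ (congrArg _ ?_)) (congrArg _ ?_) <;> push_cast <;> ring
  have hneg : (-1 : ℂ) ^ (-m) = (-1) ^ m := by rw [zpow_neg, ← inv_zpow]; norm_num
  have hdiv : ∀ m : ℤ, m * (9 * m - 5) / 2 = choose2 m + 2 * choose2 (2 * m) := fun m => by
    have h1 := two_mul_choose2 m
    have h2 := two_mul_choose2 (2 * m)
    exact Int.ediv_eq_of_eq_mul_right two_ne_zero (by linarith)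
  have e1 : q ^ (choose2 (-m) + 2 * choose2 (2 * -m)) * (1 + q ^ (-m)) =
      q ^ (choose2 m + 2 * choose2 (2 * m)) * (1 + q ^ m) * q ^ (2 * (2 * m)) := by
    have h1 := two_mul_choose2 m
    have h2 := two_mul_choose2 (2 * m)
    have h3 := two_mul_choose2 (-m)
    have h4 := two_mul_choose2 (2 * -m)
    have h5 : q ^ (choose2 (-m) + 2 * choose2 (2 * -m)) =
        q ^ (choose2 m + 2 * choose2 (2 * m)) * q ^ m * q ^ (2 * (2 * m)) := by
      rw [← zpow_add₀ hq0, ← zpow_add₀ hq0]; congr 1; linarith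
    have h6 : q ^ m * q ^ (-m) = 1 := by rw [← zpow_add₀ hq0]; simp
    rw [h5]
    linear_combination (q ^ (choose2 m + 2 * choose2 (2 * m)) * q ^ (2 * (2 * m))) * h6
  have e2 : q ^ (((n + 1 : ℕ) : ℤ) * ((n + 1 : ℕ) + 2)) = q ^ ((n + 1) * (n + 1 + 2)) := by
    rw [← zpow_natCast]; push_cast; rfl
  rw [← weight_mul_qBinom hq0 hq, mul_div_assoc, weight_eq hq]
  simp only [doubleSummand]
  have e3 : q ^ choose2 m * q ^ (2 * choose2 (2 * m)) = q ^ (choose2 m + 2 * choose2 (2 * m)) := by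
    rw [← zpow_add₀ hq0]
  rw [hsymm, hdiv, hdiv, zpow_add₀ hq0 (_ * _), zpow_add₀ hq0 (((n + 1 : ℕ) : ℤ) * _), hneg, e2]
  generalize qBinom (q ^ 2) (2 * ((n + 1 : ℕ) : ℤ) - 1) ((n + 1 : ℕ) - 2 * m) = A
  generalize qBinom (q ^ 2) (2 * ((n + 1 : ℕ) : ℤ) - 1) ((n + 1 : ℕ) - 2 * m - 1) = B
  generalize qPoch q (q ^ 2) (n + 1) * qPoch (q ^ 4) (q ^ 4) (n + 1) = D
  linear_combination ((-1) ^ m * (1 + q ^ m) * q ^ ((n + 1) * (n + 1 + 2)) / D *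
    (A + q ^ (2 * (2 * m)) * B)) * e3 - ((-1) ^ m * q ^ ((n + 1) * (n + 1 + 2)) / D * B) * e1

theorem hasSum_doubleSummand {q : ℂ} (hq0 : q ≠ 0) (hq : ‖q‖ < 1) (n : ℕ) :
    HasSum (doubleSummand q (n + 1)) (doubleTerm q (n + 1)) := by
  refine hasSum_sum_of_ne_finset_zero fun m hm => ?_
  rw [mem_Icc, not_and_or, not_le, not_le] at hm
  have : qBinom (q ^ 2) (2 * ((n + 1 : ℕ) : ℤ) - 1) ((n + 1 : ℕ) - 2 * m) = 0 := by
    rw [show 2 * ((n + 1 : ℕ) : ℤ) - 1 = (2 * n + 1 : ℕ) by push_cast; ring,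
      qBinom_eq_recipQFact (pow_ne_zero _ hq0) (norm_sq_lt_one hq)]
    rcases hm with h | h
    · rw [recipQFact_of_neg (q ^ 2) (k := ((2 * n + 1 : ℕ) : ℤ) - _) (by omega), mul_zero]
    · rw [recipQFact_of_neg (q ^ 2) (k := ((n + 1 : ℕ) : ℤ) - _) (by omega), mul_zero, zero_mul]
  rw [doubleSummand, this, mul_zero]

theorem lhsTerm_zero_succ {q : ℂ} (hq0 : q ≠ 0) (hq : ‖q‖ < 1) (n : ℕ) :
    lhsTerm q 0 (n + 1) = 2 * doubleTerm q (n + 1) := by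
  have h1 := hasSum_doubleSummand hq0 hq n
  have h2 := h1.add ((Equiv.neg ℤ).hasSum_iff.mpr h1)
  rw [lhsTerm_zero_eq hq0 hq, (h2.congr_fun fun m => summand_eq_add hq0 hq n m).tsum_eq, two_mul]

theorem lhsTerm_zero_zero {q : ℂ} (hq0 : q ≠ 0) (hq : ‖q‖ < 1) : lhsTerm q 0 0 = 2 := by
  rw [lhsTerm_zero_eq hq0 hq, tsum_eq_single 0 fun m hm => by
    rw [baileyTerm_eq_zero (by simp; omega), mul_zero]]
  norm_num [baileyTerm, choose2, recipQFact]

theorem hasSum_doubleTerm {q : ℂ} (hq0 : q ≠ 0) (hq : ‖q‖ < 1) :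
    HasSum (fun n : ℕ => doubleTerm q (n + 1))
      (qPochInf (q ^ 2) (q ^ 4) / qPochInf q q * ∑' j, rhsTerm q 0 j - 1) := by
  -- The n = 0 term equals 2, so after halving it accounts for the 1 in the identity.
  have h1 := (((hasSum_nat_add_iff' 1).mpr (hasSum_lhsTerm_eq hq0 hq 0)).mul_left (1 / 2 : ℂ))
  have n1 := qPochInf_self_ne_zero hq
  have n3 := qPochInf_self_ne_zero (norm_pow_four_lt_one hq)
  refine (congrArg (HasSum _) ?_).mpr (h1.congr_fun fun n => ?_)
  · rw [sum_range_one, lhsTerm_zero_zero hq0 hq, ← qPochInf_sq_mul hq]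
    field_simp
  · rw [lhsTerm_zero_succ hq0 hq]; ring

end

theorem mainTheorem12 (q : ℂ) (hq0 : q ≠ 0) (hq1 : ‖q‖ < 1) :
    (∀ l : ℕ,
      (∀ n : ℕ, (Function.support (innerTerm q l n)).Finite) ∧
      Summable (rhsTerm q l) ∧
      HasSum (lhsTerm q l)
        (2 * qPochInf (q ^ 2) (q ^ 2) / (qPochInf q q * qPochInf (q ^ 4) (q ^ 4))
          * ∑' j : ℕ, rhsTerm q l j)) ∧
    (Summable (fun n : ℕ => doubleTerm q (n + 1)) ∧
      1 + ∑' n : ℕ, doubleTerm q (n + 1) =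
        qPochInf (q ^ 2) (q ^ 4) / qPochInf q q
          * (qPochInf (q ^ 6) (q ^ 17) * qPochInf (q ^ 11) (q ^ 17) * qPochInf (q ^ 17) (q ^ 17)
            - q * (qPochInf (q ^ 2) (q ^ 17) * qPochInf (q ^ 15) (q ^ 17)
                * qPochInf (q ^ 17) (q ^ 17)))) := by
  refine ⟨fun l => ⟨support_innerTerm_finite hq0 hq1 l, summable_rhsTerm hq0 hq1 l,
    hasSum_lhsTerm_eq hq0 hq1 l⟩, (hasSum_doubleTerm hq0 hq1).summable, ?_⟩
  rw [(hasSum_doubleTerm hq0 hq1).tsum_eq, tsum_rhsTerm_zero hq0 hq1, add_sub_cancel]
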